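/- All graphs are finite, undirected and simple. $K_m$ is the complete graph on $m$ vertices, $tK_1$ is the graph with $t$ vertices and no edges, $\cup$ is the disjoint union, and $G_1\vee G_2$ is obtained from $G_1\cup G_2$ by adding all edges between $V(G_1)$ and $V(G_2)$. A graph is $k$-connected if it has more than $k$ vertices and it stays connected after the deletion of any set of fewer than $k$ vertices. For a connected graph $G$, let $D(G)$ be its distance matrix, let $Tr(G)$ be the diagonal matrix whose entry at $v$ is the sum of the distances from $v$ to all vertices, and let $\eta_1(G)$ be the largest eigenvalue of the distance signless Laplacian matrix $Q_D(G)=D(G)+Tr(G)$. For an odd integer $b\ge 1$, a $[1,b]$-odd factor of a graph is a spanning subgraph in which every vertex has degree in $\{1,3,\dots,b\}$. For an integer $k\ge1$, a graph $G$ of order at least $k+2$ is $k$-critical with respect to $[1,b]$-odd factors if $G-X$ contains a $[1,b]$-odd factor for every $X\subseteq V(G)$ with $|X|=k$. **Theorem 1.6.** Let $b$, $k$ and $n$ be positive integers with $n\equiv k\pmod 2$, $b\equiv 1\pmod 2$ and $b\ge k$, and let $G$ be a $(k+1)$-connected graph of order $n$ with minimum degree $\delta$, where $$n\ \ge\ \max\Big\{(2b^2+4b)\delta^2+2\delta+2b^2k^2,\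 \ \tfrac65 b^2\delta^3+\tfrac85 b^2k\delta^2\Big\}.$$ If $$\eta_1(G)\ \le\ \eta_1\big(K_\delta\vee(K_{n-(b+1)\delta+bk-1}\cup(b\delta-bk+1)K_1)\big),$$ then $G$ is $k$-critical with respect to $[1,b]$-odd factors, unless $$G\cong K_\delta\vee(K_{n-(b+1)\delta+bk-1}\cup(b\delta-bk+1)K_1).$$ -/

import Mathlib

/-- `G` is `k`-connected: it has more than `k` vertices, and deleting fewer than `k` vertices always
leaves a connected graph. -/
def IsKConnected {V : Type*} [Fintype V] (G : SimpleGraph V) (k : ℕ) : Prop :=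
  k < Fintype.card V ∧
    ∀ X : Finset V, X.card < k → (G.induce {v : V | v ∉ X}).Connected

open Classical in
/-- `G` contains a `[1,b]`-odd factor: a spanning subgraph `H` with all degrees in `{1, 3, …, b}`,
where `b` is odd. -/
def HasOddFactor {V : Type*} [Fintype V] (G : SimpleGraph V) (b : ℕ) : Prop :=
  Odd b ∧ ∃ H : SimpleGraph V, H ≤ G ∧ ∀ v : V, Odd (H.degree v) ∧ H.degree v ≤ b

open Classical in
/-- `G`, of order at least `k + 2`, is `k`-critical with respect to `[1,b]`-odd factors: `G - X`
contains a `[1,b]`-odd factor for every set `X` of exactly `k` vertices. -/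
def IsKCriticalOddFactor {V : Type*} [Fintype V] (G : SimpleGraph V) (k b : ℕ) : Prop :=
  k + 2 ≤ Fintype.card V ∧
    ∀ X : Finset V, X.card = k → HasOddFactor (G.induce {v : V | v ∉ X}) b

/-- The transmission of a vertex: the sum of its distances to all vertices. -/
noncomputable def transmission {V : Type*} [Fintype V] (G : SimpleGraph V) (v : V) : ℝ :=
  ∑ w : V, (G.dist v w : ℝ)

/-- The distance matrix. -/
noncomputable def distMatrix {V : Type*} (G : SimpleGraph V) : Matrix V V ℝ :=
  Matrix.of fun u v => (G.dist u v : ℝ)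

/-- The distance signless Laplacian matrix: the distance matrix plus the diagonal matrix of vertex
transmissions. -/
noncomputable def distSignlessLaplacian {V : Type*} [Fintype V] [DecidableEq V]
    (G : SimpleGraph V) : Matrix V V ℝ :=
  distMatrix G + Matrix.diagonal (transmission G)

/-- The distance signless Laplacian spectral radius `η₁(G)`: the largest eigenvalue of the distance
signless Laplacian matrix. The supremum is attained, see `isGreatest_distSignlessRadius`. -/
noncomputable def distSignlessRadius {V : Type*} [Fintype V] [DecidableEq V]
    (G : SimpleGraph V) : ℝ :=
  sSup {x : ℝ | Module.End.HasEigenvalue (Matrix.toLin' (distSignlessLaplacian G)) x}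

theorem isHermitian_distSignlessLaplacian {V : Type*} [Fintype V] [DecidableEq V]
    (G : SimpleGraph V) : (distSignlessLaplacian G).IsHermitian := by
  refine Matrix.IsHermitian.add ?_ ?_
  · ext u v
    simp [distMatrix, SimpleGraph.dist_comm]
  · exact Matrix.isHermitian_diagonal _

theorem isGreatest_distSignlessRadius {V : Type*} [Fintype V] [DecidableEq V] [Nonempty V]
    (G : SimpleGraph V) :
    IsGreatest {x : ℝ | Module.End.HasEigenvalue (Matrix.toLin' (distSignlessLaplacian G)) x}
      (distSignlessRadius G) := by
  have hfin : {x : ℝ |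
      Module.End.HasEigenvalue (Matrix.toLin' (distSignlessLaplacian G)) x}.Finite := by
    simp only [Module.End.hasEigenvalue_iff_mem_spectrum, Set.ofPred_mem_eq]
    exact Module.End.finite_spectrum _
  have hne : {x : ℝ |
      Module.End.HasEigenvalue (Matrix.toLin' (distSignlessLaplacian G)) x}.Nonempty := by
    refine ⟨(isHermitian_distSignlessLaplacian G).eigenvalues (Classical.arbitrary V), ?_⟩
    simp only [Module.End.hasEigenvalue_iff_mem_spectrum, Set.mem_ofPred_eq, Matrix.spectrum_toLin']
    exact (isHermitian_distSignlessLaplacian G).eigenvalues_mem_spectrum_real _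
  exact ⟨hne.csSup_mem hfin, fun x hx => le_csSup hfin.bddAbove hx⟩

/-- The join `G ∨ H`: the disjoint union together with all edges between the two sides. -/
def graphJoin {V W : Type*} (G : SimpleGraph V) (H : SimpleGraph W) : SimpleGraph (V ⊕ W) :=
  (G ⊕g H) ⊔ completeBipartiteGraph V W

/-- The graph `K_s ∨ (K_m ∪ t K₁)`. -/
def joinCliqueIndep (s m t : ℕ) : SimpleGraph (Fin s ⊕ (Fin m ⊕ Fin t)) :=
  graphJoin (SimpleGraph.completeGraph (Fin s))
    (SimpleGraph.completeGraph (Fin m) ⊕g SimpleGraph.emptyGraph (Fin t))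

/-- The graph `K_δ ∨ (K_{n-(b+1)δ+bk-1} ∪ (bδ-bk+1) K₁)`. The subtractions do not truncate when
`k ≤ δ` and `(b+1)δ + 1 ≤ n + bk`. -/
def extremalGraph (n b k δ : ℕ) :
    SimpleGraph (Fin δ ⊕ (Fin (n + b * k - (b + 1) * δ - 1) ⊕ Fin (b * δ - b * k + 1))) :=
  joinCliqueIndep δ (n + b * k - (b + 1) * δ - 1) (b * δ - b * k + 1)

/-! If `G` is not `k`-critical, then some `G - X` with `|X| = k` has no odd factor. A perfect
matching of the graph in which every vertex is replaced by a clique of `b` clones yields a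
`[1,b]`-odd factor, so Tutte's theorem in the clone graph, sharpened by parity, gives a set `S`
containing `X`, with `s = |S| > k`, such that the vertices outside `S` fall into exactly `b(s-k)+2`
nonempty classes with no edges between different classes (`exists_separator_of_not_critical`).

The radii are compared by transplanting a vector. Twice the quadratic form of the distance signless
Laplacian is the sum of `d(u,v)(x u + x v)²` over ordered pairs. Distances between distinct vertices
are at least 1, and at least 2 between different classes, so the form in `G` is at least that of the
complete graph plus `sepForm`. The extremal graph is `K_δ ∨ (K_m ∪ p K₁)` with `p = b(δ-k)+1` and
Perron values `a`, `1`, `r`. If these values are placed on `δ`, `m` and `p` vertices of `G`, the sum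
and the norm are those of the Perron vector, and the hypothesis on the radii bounds `sepForm` by the
corresponding quantity of the extremal graph (`sepForm_le_of_radius_le`). The Perron equations give
`p(r²-r)+r ≤ m`, which keeps the losses of order `(1+r)²` below the gains of order `m`.

If `s ≥ δ`, put `a` on `δ` vertices of `S` and `r` on one representative of each of `p` classes
other than a largest one. The comparison then forces `s = δ`, singleton classes apart from the
largest, and no missing edge beyond those between classes (`gain_le_loss_of_large_separator`): this
is the extremal graph. If `s < δ`, the minimum degree makes every class have more than `δ-s`
vertices; put `a` on `S` and on `δ-s` vertices of the largest class, and spread `r` over the others.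
The resulting inequality is false (`gain_le_loss_of_small_separator`). For `b = 1` and `s`
comparable to `n` this vector is replaced by `1` on `S` and `2` elsewhere
(`rayleigh_separator_one_two`). -/

/-! ### The quadratic form and Rayleigh's principle. -/

open Matrix in
theorem dotProduct_distSignlessLaplacian_mulVec {V : Type*} [Fintype V] [DecidableEq V]
    (G : SimpleGraph V) (x : V → ℝ) :
    2 * (x ⬝ᵥ (distSignlessLaplacian G *ᵥ x)) =
      ∑ u, ∑ v, (G.dist u v : ℝ) * (x u + x v) ^ 2 := by
  have h1 : x ⬝ᵥ (distSignlessLaplacian G *ᵥ x) =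
      ∑ u, ∑ v, (G.dist u v : ℝ) * (x u * x v + x u ^ 2) := by
    rw [distSignlessLaplacian, Matrix.add_mulVec, dotProduct_add, dotProduct, dotProduct,
      ← Finset.sum_add_distrib]
    refine Finset.sum_congr rfl fun u _ => ?_
    rw [Matrix.mulVec_diagonal, Matrix.mulVec, dotProduct, transmission, Finset.sum_mul,
      Finset.mul_sum, Finset.mul_sum, ← Finset.sum_add_distrib]
    refine Finset.sum_congr rfl fun v _ => ?_
    simp only [distMatrix, Matrix.of_apply]
    ring
  have h2 : ∑ u, ∑ v, (G.dist u v : ℝ) * (x u * x v + x u ^ 2) =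
      ∑ u, ∑ v, (G.dist u v : ℝ) * (x u * x v + x v ^ 2) := by
    rw [Finset.sum_comm]
    refine Finset.sum_congr rfl fun u _ => Finset.sum_congr rfl fun v _ => ?_
    rw [SimpleGraph.dist_comm]
    ring
  rw [h1, two_mul]
  nth_rw 1 [h2]
  rw [← Finset.sum_add_distrib]
  refine Finset.sum_congr rfl fun u _ => ?_
  rw [← Finset.sum_add_distrib]
  exact Finset.sum_congr rfl fun v _ => by ring

/-- An eigenvalue `e` of this difference makes `η₁ - e` an eigenvalue of the distance signless
Laplacian, hence at most `η₁`. Semidefiniteness gives Rayleigh's inequality and also its equality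
case: a vector on which the form vanishes lies in the kernel. -/
theorem posSemidef_distSignlessRadius_sub {V : Type*} [Fintype V] [DecidableEq V] [Nonempty V]
    (G : SimpleGraph V) :
    (distSignlessRadius G • (1 : Matrix V V ℝ) - distSignlessLaplacian G).PosSemidef := by
  have hM : (distSignlessRadius G • (1 : Matrix V V ℝ) - distSignlessLaplacian G).IsHermitian := by
    refine Matrix.IsHermitian.sub ?_ (isHermitian_distSignlessLaplacian G)
    rw [Matrix.IsHermitian, Matrix.conjTranspose_smul, Matrix.conjTranspose_one]
    simp
  rw [hM.posSemidef_iff_eigenvalues_nonneg]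
  intro i
  have h := hM.mulVec_eigenvectorBasis i
  set w : V → ℝ := (hM.eigenvectorBasis i).ofLp with hw
  have hw0 : w ≠ 0 := by
    intro h0
    apply hM.eigenvectorBasis.orthonormal.ne_zero i
    ext j
    exact congrFun h0 j
  rw [Matrix.sub_mulVec, Matrix.smul_mulVec, Matrix.one_mulVec] at h
  have hev : Module.End.HasEigenvalue (Matrix.toLin' (distSignlessLaplacian G))
      (distSignlessRadius G - hM.eigenvalues i) := by
    refine Module.End.hasEigenvalue_of_hasEigenvector (x := w) ⟨?_, hw0⟩
    rw [Module.End.mem_eigenspace_iff, Matrix.toLin'_apply, sub_smul, ← h]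
    abel
  have := (isGreatest_distSignlessRadius G).2 hev
  simp only [Pi.zero_apply]
  linarith

open Matrix in
theorem sum_dist_mul_le {V : Type*} [Fintype V] [DecidableEq V] [Nonempty V]
    (G : SimpleGraph V) (x : V → ℝ) :
    ∑ u, ∑ v, (G.dist u v : ℝ) * (x u + x v) ^ 2 ≤ 2 * (distSignlessRadius G * ∑ v, x v ^ 2) := by
  have h := (posSemidef_distSignlessRadius_sub G).dotProduct_mulVec_nonneg x
  rw [Matrix.sub_mulVec, Matrix.smul_mulVec, Matrix.one_mulVec, dotProduct_sub] at h
  have h2 : star x ⬝ᵥ (distSignlessRadius G • x) = distSignlessRadius G * ∑ v, x v ^ 2 := by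
    simp [dotProduct, Finset.mul_sum]
    exact Finset.sum_congr rfl fun v _ => by ring
  rw [← dotProduct_distSignlessLaplacian_mulVec]
  rw [h2] at h
  simp only [star_trivial] at h
  linarith

open Matrix in
/-- The largest eigenvalue has a nonnegative eigenvector. -/
theorem exists_nonneg_eigenvector {V : Type*} [Fintype V] [DecidableEq V] [Nonempty V]
    (G : SimpleGraph V) :
    ∃ w : V → ℝ, (∀ v, 0 ≤ w v) ∧ w ≠ 0 ∧
      distSignlessLaplacian G *ᵥ w = distSignlessRadius G • w := by
  obtain ⟨z, hz⟩ := (isGreatest_distSignlessRadius G).1.exists_hasEigenvector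
  have hz1 : distSignlessLaplacian G *ᵥ z = distSignlessRadius G • z := by
    have := hz.1
    rwa [Module.End.mem_eigenspace_iff, Matrix.toLin'_apply] at this
  -- Passing from `z` to `|z|` keeps the norm and does not decrease any `(z u + z v)²`, so `|z|`
  -- attains the maximum as well.
  have hsq : 2 * (distSignlessRadius G * ∑ v, |z v| ^ 2) ≤
      ∑ u, ∑ v, (G.dist u v : ℝ) * (|z u| + |z v|) ^ 2 := by
    have h1 := dotProduct_distSignlessLaplacian_mulVec G z
    rw [hz1] at h1
    have h2 : z ⬝ᵥ (distSignlessRadius G • z) = distSignlessRadius G * ∑ v, |z v| ^ 2 := by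
      simp [dotProduct, Finset.mul_sum]
      exact Finset.sum_congr rfl fun v _ => by ring
    rw [← h2, h1]
    refine Finset.sum_le_sum fun u _ => Finset.sum_le_sum fun v _ => ?_
    refine mul_le_mul_of_nonneg_left ?_ (Nat.cast_nonneg _)
    rw [← sq_abs (z u + z v)]
    exact pow_le_pow_left₀ (abs_nonneg _) (abs_add_le _ _) 2
  refine ⟨fun v => |z v|, fun v => abs_nonneg _, ?_, ?_⟩
  · intro h
    exact hz.2 (funext fun v => abs_eq_zero.1 (congrFun h v))
  · have h0 := ((posSemidef_distSignlessRadius_sub G).dotProduct_mulVec_zero_iff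
      (fun v => |z v|)).1 ?_
    · rw [Matrix.sub_mulVec, Matrix.smul_mulVec, Matrix.one_mulVec, sub_eq_zero] at h0
      exact h0.symm
    · refine le_antisymm ?_ ((posSemidef_distSignlessRadius_sub G).dotProduct_mulVec_nonneg _)
      rw [Matrix.sub_mulVec, Matrix.smul_mulVec, Matrix.one_mulVec, dotProduct_sub]
      simp only [star_trivial]
      have h1 := dotProduct_distSignlessLaplacian_mulVec G (fun v => |z v|)
      have h2 : (fun v => |z v|) ⬝ᵥ (distSignlessRadius G • (fun v => |z v|)) =
          distSignlessRadius G * ∑ v, |z v| ^ 2 := by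
        simp only [dotProduct, Finset.mul_sum, Pi.smul_apply, smul_eq_mul]
        exact Finset.sum_congr rfl fun v _ => by ring
      rw [h2]
      linarith

open Classical in
/-- Rayleigh bound in terms of the pairs of nonadjacent vertices. -/
theorem rayleigh_nonadj {V : Type*} [Fintype V] [DecidableEq V]
    {G : SimpleGraph V} (hG : G.Connected) (x : V → ℝ) :
    2 * (((Fintype.card V : ℝ) - 2) * ∑ v, x v ^ 2 + (∑ v, x v) ^ 2) +
      ∑ u, ∑ v, (if u ≠ v ∧ ¬ G.Adj u v then (x u + x v) ^ 2 else 0) ≤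
    2 * (distSignlessRadius G * ∑ v, x v ^ 2) := by
  have := hG.nonempty
  refine le_trans ?_ (sum_dist_mul_le G x)
  -- This is the form of the complete graph, which accounts for one unit of every distance;
  -- nonadjacent pairs contribute at least one unit more.
  have h1 : 2 * (((Fintype.card V : ℝ) - 2) * ∑ v, x v ^ 2 + (∑ v, x v) ^ 2) =
      ∑ u, ∑ v, (if u ≠ v then (x u + x v) ^ 2 else 0) := by
    have e1 : ∀ u v, (if u ≠ v then (x u + x v) ^ 2 else 0) =
        (x u + x v) ^ 2 - if u = v then 4 * x u ^ 2 else 0 := by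
      intro u v
      by_cases h : u = v
      · subst h
        simp
        ring
      · simp [h]
    have e2 : ∀ u, ∑ v, (x u + x v) ^ 2 =
        Fintype.card V * x u ^ 2 + 2 * x u * ∑ v, x v + ∑ v, x v ^ 2 := by
      intro u
      rw [Finset.mul_sum, ← nsmul_eq_mul, ← Finset.card_univ, ← Finset.sum_const,
        ← Finset.sum_add_distrib, ← Finset.sum_add_distrib]
      exact Finset.sum_congr rfl fun v _ => by ring
    simp only [e1, Finset.sum_sub_distrib, e2, Finset.sum_ite_eq, Finset.mem_univ, if_true,
      Finset.sum_add_distrib, ← Finset.mul_sum, ← Finset.sum_mul, Finset.sum_const,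
      Finset.card_univ, nsmul_eq_mul]
    ring
  rw [h1, ← Finset.sum_add_distrib]
  refine Finset.sum_le_sum fun u _ => ?_
  rw [← Finset.sum_add_distrib]
  refine Finset.sum_le_sum fun v _ => ?_
  by_cases huv : u = v
  · simp [huv]
  · have hpos := hG.pos_dist_of_ne huv
    by_cases ha : G.Adj u v
    · simp [huv, ha, SimpleGraph.dist_eq_one_iff_adj.2 ha]
    · have h2 : 2 ≤ G.dist u v := by
        have : G.dist u v ≠ 1 := fun h => ha (SimpleGraph.dist_eq_one_iff_adj.1 h)
        omega
      have h3 : (2 : ℝ) ≤ G.dist u v := by exact_mod_cast h2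
      simp only [huv, ha, ne_eq, not_false_eq_true, and_self, if_true]
      nlinarith [sq_nonneg (x u + x v)]

/-! ### Odd factors through perfect matchings, and Tutte separators. -/

/-- The lexicographic product of `H` with the complete graph on `b` vertices: every vertex is
replaced by a clique of `b` clones. -/
def cloneGraph {W : Type*} (H : SimpleGraph W) (b : ℕ) : SimpleGraph (W × Fin b) where
  Adj x y := H.Adj x.1 y.1 ∨ (x.1 = y.1 ∧ x.2 ≠ y.2)
  symm := ⟨by
    rintro x y (h | ⟨h, h'⟩)
    · exact Or.inl h.symm
    · exact Or.inr ⟨h.symm, h'.symm⟩⟩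
  loopless := ⟨by
    rintro x (h | ⟨_, h⟩)
    · exact H.loopless.irrefl _ h
    · exact h rfl⟩

theorem Finset.even_card_of_involution {α : Type*} (s : Finset α) (g : α → α)
    (hmem : ∀ a ∈ s, g a ∈ s) (hne : ∀ a ∈ s, g a ≠ a) (hinv : ∀ a ∈ s, g (g a) = a) :
    Even s.card := by
  have h : ∑ _a ∈ s, (1 : ZMod 2) = 0 :=
    Finset.sum_involution (fun a _ => g a) (fun _ _ => by decide) (fun a ha _ => hne a ha)
      (fun a ha => hmem a ha) (fun a ha => hinv a ha)
  rw [Finset.sum_const, nsmul_eq_mul, mul_one] at h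
  exact (ZMod.natCast_eq_zero_iff_even).1 h

/-- A perfect matching of the clone graph yields a `[1,b]`-odd factor: keep the edges that carry an
odd number of matching edges. -/
theorem hasOddFactor_of_isPerfectMatching {W : Type*} [Fintype W] (H : SimpleGraph W) {b : ℕ}
    (hb : Odd b) (M : (cloneGraph H b).Subgraph) (hM : M.IsPerfectMatching) :
    HasOddFactor H b := by
  classical
  rw [SimpleGraph.Subgraph.isPerfectMatching_iff] at hM
  choose φ hφ hφu using hM
  have hinv : ∀ a, φ (φ a) = a := fun a => ((hφu (φ a)) a (hφ a).symm).symm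
  have hne : ∀ a, φ a ≠ a := fun a h => by
    have := hφ a
    rw [h] at this
    exact M.loopless.irrefl _ this
  set c : W → W → ℕ := fun u v => (Finset.univ.filter fun i : Fin b => (φ (u, i)).1 = v).card
    with hc
  have hsymm : ∀ u v, c u v = c v u := by
    have key : ∀ u v, c u v ≤ c v u := by
      intro u v
      refine Finset.card_le_card_of_injOn (fun i => (φ (u, i)).2) ?_ ?_
      · intro i hi
        simp only [Finset.coe_filter, Finset.mem_univ, true_and, Set.mem_ofPred_eq] at hi ⊢
        have : (v, (φ (u, i)).2) = φ (u, i) := by rw [← hi]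
        rw [this, hinv]
      · intro i hi j hj hij
        simp only [Finset.coe_filter, Finset.mem_univ, true_and, Set.mem_ofPred_eq] at hi hj hij
        have h1 : φ (u, i) = φ (u, j) := Prod.ext (hi.trans hj.symm) hij
        have h2 := congrArg φ h1
        rw [hinv, hinv] at h2
        exact congrArg Prod.snd h2
    exact fun u v => le_antisymm (key u v) (key v u)
  have hsum : ∀ u, ∑ v, c u v = b := by
    intro u
    have := Finset.card_eq_sum_card_fiberwise (f := fun i : Fin b => (φ (u, i)).1)
      (s := Finset.univ) (t := Finset.univ) (fun _ _ => Finset.mem_coe.2 (Finset.mem_univ _))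
    rw [Finset.card_univ, Fintype.card_fin] at this
    exact this.symm
  -- Clones of `u` matched among themselves come in pairs. Hence the sum of `c u v` over `v ≠ u` has
  -- the parity of `b`, and the number of odd terms is odd.
  have heven : ∀ u, Even (c u u) := by
    intro u
    have key : ∀ i : Fin b, (φ (u, i)).1 = u → (u, (φ (u, i)).2) = φ (u, i) := by
      exact fun i hi => Prod.ext hi.symm rfl
    refine Finset.even_card_of_involution _ (fun i => (φ (u, i)).2) ?_ ?_ ?_
    · intro i hi
      simp only [Finset.mem_filter, Finset.mem_univ, true_and] at hi ⊢
      rw [key i hi, hinv]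
    · intro i hi h
      simp only [Finset.mem_filter, Finset.mem_univ, true_and] at hi
      have := key i hi
      rw [h] at this
      exact hne _ this.symm
    · intro i hi
      simp only [Finset.mem_filter, Finset.mem_univ, true_and] at hi
      rw [key i hi, hinv]
  have hadj : ∀ u v, u ≠ v → c u v ≠ 0 → H.Adj u v := by
    intro u v huv h
    obtain ⟨i, hi⟩ := Finset.card_pos.1 (Nat.pos_of_ne_zero h)
    simp only [Finset.mem_filter, Finset.mem_univ, true_and] at hi
    rcases M.adj_sub (hφ (u, i)) with h1 | ⟨h1, _⟩
    · rwa [hi] at h1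
    · exact absurd (h1.trans hi) huv
  obtain ⟨K, hK⟩ : ∃ K : SimpleGraph W, ∀ u v, K.Adj u v ↔ u ≠ v ∧ Odd (c u v) :=
    ⟨⟨fun u v => u ≠ v ∧ Odd (c u v), ⟨fun u v h => ⟨h.1.symm, hsymm u v ▸ h.2⟩⟩,
      ⟨fun u h => h.1 rfl⟩⟩, fun u v => Iff.rfl⟩
  refine ⟨hb, K, fun u v h => hadj u v ((hK u v).1 h).1 fun h0 => ?_, fun u => ?_⟩
  · have := ((hK u v).1 h).2
    rw [h0] at this
    exact absurd this (by decide)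
  · have hdeg : K.neighborFinset u = (Finset.univ.erase u).filter fun v => Odd (c u v) := by
      ext v
      rw [SimpleGraph.mem_neighborFinset, hK]
      simp [eq_comm]
    rw [← SimpleGraph.card_neighborFinset_eq_degree, hdeg, ← Finset.odd_sum_iff_odd_card_odd]
    have h1 := Finset.add_sum_erase Finset.univ (c u) (Finset.mem_univ u)
    rw [hsum] at h1
    constructor
    · have h2 := heven u
      rw [← h1] at hb
      rw [Nat.odd_add] at hb
      by_contra h3
      exact (Nat.not_odd_iff_even.2 h2) (hb.2 (Nat.not_odd_iff_even.1 h3))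
    · calc _ ≤ ∑ v ∈ (Finset.univ.erase u).filter fun v => Odd (c u v), c u v := by
            rw [Finset.card_eq_sum_ones]
            refine Finset.sum_le_sum fun v hv => ?_
            exact (Finset.mem_filter.1 hv).2.pos
        _ ≤ ∑ v ∈ Finset.univ.erase u, c u v :=
            Finset.sum_le_sum_of_subset (Finset.filter_subset _ _)
        _ ≤ b := by omega

/-- A graph of even order without `[1,b]`-odd factor has a vertex set `S` whose deletion leaves at
least `b|S| + 2` components; `f` groups them into exactly that many classes. -/
theorem exists_separator_of_not_hasOddFactor {W : Type*} [Fintype W] (H : SimpleGraph W) {b : ℕ}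
    (hb : Odd b) (hW : Even (Fintype.card W)) (hH : ¬ HasOddFactor H b) :
    ∃ (S : Finset W) (f : W → Fin (b * S.card + 2)),
      (∀ u v, u ∉ S → v ∉ S → H.Adj u v → f u = f v) ∧ ∀ i, ∃ v, v ∉ S ∧ f v = i := by
  classical
  have h1 : ¬ ∃ M : (cloneGraph H b).Subgraph, M.IsPerfectMatching :=
    fun ⟨M, hM⟩ => hH (hasOddFactor_of_isPerfectMatching H hb M hM)
  rw [SimpleGraph.tutte] at h1
  push Not at h1
  obtain ⟨u, hu⟩ := h1
  rw [SimpleGraph.IsTutteViolator] at hu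
  set K := ((⊤ : (cloneGraph H b).Subgraph).deleteVerts u).coe with hK
  have hcardK : Nat.card ((⊤ : (cloneGraph H b).Subgraph).deleteVerts u).verts + u.ncard =
      Fintype.card W * b := by
    have e : ((⊤ : (cloneGraph H b).Subgraph).deleteVerts u).verts = uᶜ := by
      simp [Set.compl_eq_univ_sdiff]
    rw [e, Nat.card_coe_set_eq, add_comm, Set.ncard_add_ncard_compl, Nat.card_eq_fintype_card,
      Fintype.card_prod, Fintype.card_fin]
  -- The number of odd components has the parity of `|K|`, and hence of `|u|` because `|W| b` is
  -- even; a Tutte violator therefore exceeds `|u|` by at least 2.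
  have hcount : u.ncard + 2 ≤ Nat.card K.ConnectedComponent := by
    have h2 := SimpleGraph.odd_ncard_oddComponents (G := K)
    have h3 : K.oddComponents.ncard ≤ Nat.card K.ConnectedComponent := by
      rw [← Set.ncard_univ]
      exact Set.ncard_le_ncard (Set.subset_univ _) (Set.toFinite _)
    have h4 : Even (Fintype.card W * b) := hW.mul_right b
    rw [← hcardK, Nat.even_add] at h4
    rcases Nat.even_or_odd u.ncard with h5 | h5
    · have h6 : Even K.oddComponents.ncard := by
        rw [← Nat.not_odd_iff_even, h2, Nat.not_odd_iff_even]
        exact h4.2 h5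
      obtain ⟨i, hi⟩ := h5
      obtain ⟨j, hj⟩ := h6
      omega
    · have h6 : Odd K.oddComponents.ncard := by
        rw [h2, ← Nat.not_even_iff_odd, h4, Nat.not_even_iff_odd]
        exact h5
      obtain ⟨i, hi⟩ := h5
      obtain ⟨j, hj⟩ := h6
      omega
  -- A vertex survives as soon as one of its clones does, so only vertices with all `b` clones in
  -- `u` are deleted; this gives `b|S| ≤ |u|`.
  set S : Finset W := Finset.univ.filter fun v => ∀ i, (v, i) ∈ u with hS
  have hSu : b * S.card ≤ u.ncard := by
    have e : ((S ×ˢ (Finset.univ : Finset (Fin b)) : Finset (W × Fin b)) : Set (W × Fin b)) ⊆ u := by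
      rintro ⟨v, i⟩ h
      simp only [Finset.coe_product, Set.mem_prod, Finset.mem_coe, hS, Finset.mem_filter,
        Finset.mem_univ, true_and] at h
      exact h.1 i
    have := Set.ncard_le_ncard e (Set.toFinite _)
    rw [Set.ncard_coe_finset, Finset.card_product, Finset.card_univ, Fintype.card_fin] at this
    linarith [mul_comm b S.card]
  obtain ⟨h, hh⟩ : ∃ h : K.ConnectedComponent → Fin (b * S.card + 2), Function.Surjective h := by
    have : Nonempty (Fin (b * S.card + 2)) := ⟨0⟩
    obtain ⟨e⟩ : Nonempty (Fin (b * S.card + 2) ↪ K.ConnectedComponent) := by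
      have := Fintype.ofFinite K.ConnectedComponent
      refine Function.Embedding.nonempty_of_card_le ?_
      rw [Fintype.card_fin, ← Nat.card_eq_fintype_card]
      omega
    exact ⟨Function.invFun e, Function.invFun_surjective e.injective⟩
  have hmem : ∀ x : W × Fin b, x ∉ u → x ∈ ((⊤ : (cloneGraph H b).Subgraph).deleteVerts u).verts :=
    fun x hx => by simp [hx]
  have hcl : ∀ v, v ∉ S → ∃ i, (v, i) ∉ u := by
    intro v hv
    simpa [hS] using hv
  let f : W → Fin (b * S.card + 2) := fun v =>
    if hv : v ∉ S then
      h (K.connectedComponentMk ⟨(v, (hcl v hv).choose), hmem _ (hcl v hv).choose_spec⟩)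
    else 0
  -- The class does not depend on the chosen clone, since clones of one vertex are adjacent. The
  -- value `0` of `f` on `S` is irrelevant.
  have hf : ∀ v, v ∉ S → ∀ i (hi : (v, i) ∉ u), f v = h (K.connectedComponentMk ⟨(v, i), hmem _ hi⟩) := by
    intro v hv i hi
    simp only [f, dif_pos hv]
    congr 1
    by_cases hij : (hcl v hv).choose = i
    · congr 3
    · apply SimpleGraph.ConnectedComponent.sound
      apply SimpleGraph.Adj.reachable
      rw [hK, SimpleGraph.Subgraph.coe_adj, SimpleGraph.Subgraph.deleteVerts_adj]
      exact ⟨trivial, (hcl v hv).choose_spec, trivial, hi, Or.inr ⟨rfl, hij⟩⟩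
  refine ⟨S, f, ?_, ?_⟩
  · intro v w hv hw hvw
    obtain ⟨i, hi⟩ := hcl v hv
    obtain ⟨j, hj⟩ := hcl w hw
    rw [hf v hv i hi, hf w hw j hj]
    congr 1
    apply SimpleGraph.ConnectedComponent.sound
    apply SimpleGraph.Adj.reachable
    rw [hK, SimpleGraph.Subgraph.coe_adj, SimpleGraph.Subgraph.deleteVerts_adj]
    exact ⟨trivial, hi, trivial, hj, Or.inl hvw⟩
  · intro i
    obtain ⟨C, rfl⟩ := hh i
    obtain ⟨⟨⟨v, j⟩, hx⟩, rfl⟩ := C.exists_rep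
    have hj : (v, j) ∉ u := by simpa using hx
    have hv : v ∉ S := fun hv => hj ((Finset.mem_filter.1 hv).2 j)
    exact ⟨v, hv, hf v hv j hj⟩

theorem SimpleGraph.Connected.map_eq_of_adj {W α : Type*} {H : SimpleGraph W} (hH : H.Connected)
    (f : W → α) (hf : ∀ u v, H.Adj u v → f u = f v) (u v : W) : f u = f v := by
  obtain ⟨p⟩ := hH.preconnected u v
  induction p with
  | nil => rfl
  | cons h _ ih => exact (hf _ _ h).trans ih

/-- A `(k+1)`-connected graph that is not `k`-critical has a separator `S` of size at least `k + 1`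
whose deletion leaves at least `b(|S| - k) + 2` components. -/
theorem exists_separator_of_not_critical {V : Type*} [Fintype V] {G : SimpleGraph V} {b k : ℕ}
    (hb : Odd b) (hnk : Fintype.card V ≡ k [MOD 2]) (hconn : IsKConnected G (k + 1))
    (hG : ¬ IsKCriticalOddFactor G k b) :
    ∃ (S : Finset V) (f : V → Fin (b * (S.card - k) + 2)), k + 1 ≤ S.card ∧
      (∀ u v, u ∉ S → v ∉ S → G.Adj u v → f u = f v) ∧ ∀ i, ∃ v, v ∉ S ∧ f v = i := by
  classical
  have hn : k + 2 ≤ Fintype.card V := hconn.1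
  obtain ⟨X, hXk, hX⟩ : ∃ X : Finset V, X.card = k ∧
      ¬ HasOddFactor (G.induce {v : V | v ∉ X}) b := by
    by_contra h
    push Not at h
    exact hG ⟨hn, h⟩
  have hcard : Fintype.card {v : V | v ∉ X} = Fintype.card V - k := by
    rw [← hXk, ← Finset.card_compl]
    exact Fintype.card_of_subtype _ (by simp)
  have heven : Even (Fintype.card {v : V | v ∉ X}) := by
    rw [hcard, Nat.even_iff]
    unfold Nat.ModEq at hnk
    omega
  obtain ⟨S', f', hf', hs'⟩ := exists_separator_of_not_hasOddFactor _ hb heven hX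
  -- With `S'` empty, two classes would separate `G - X`, which is connected because only `k`
  -- vertices were deleted.
  have hS'0 : S'.card ≠ 0 := by
    intro h0
    rw [Finset.card_eq_zero] at h0
    subst h0
    have hc := hconn.2 X (by omega)
    obtain ⟨u, -, hu⟩ := hs' ⟨0, by omega⟩
    obtain ⟨v, -, hv⟩ := hs' ⟨1, by omega⟩
    have := hc.map_eq_of_adj f' (fun u v h => hf' u v (by simp) (by simp) h) u v
    rw [hu, hv] at this
    simp at this
  have hdisj : Disjoint X (S'.map (Function.Embedding.subtype _)) := by
    rw [Finset.disjoint_left]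
    intro v hv hv'
    obtain ⟨w, -, rfl⟩ := Finset.mem_map.1 hv'
    exact w.2 hv
  have hScard : (X ∪ S'.map (Function.Embedding.subtype _)).card = k + S'.card := by
    rw [Finset.card_union_of_disjoint hdisj, Finset.card_map, hXk]
  have hq : b * S'.card + 2 = b * ((X ∪ S'.map (Function.Embedding.subtype _)).card - k) + 2 := by
    rw [hScard, Nat.add_sub_cancel_left]
  have hout : ∀ v, v ∉ X ∪ S'.map (Function.Embedding.subtype _) →
      ∃ h : v ∈ {v : V | v ∉ X}, (⟨v, h⟩ : {v : V | v ∉ X}) ∉ S' := by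
    intro v hv
    simp only [Finset.mem_union, not_or] at hv
    exact ⟨hv.1, fun h => hv.2 (Finset.mem_map.2 ⟨_, h, rfl⟩)⟩
  refine ⟨X ∪ S'.map (Function.Embedding.subtype _),
    fun v => Fin.cast hq (if h : v ∈ {v : V | v ∉ X} then f' ⟨v, h⟩ else 0), by omega, ?_, ?_⟩
  · intro u v hu hv huv
    obtain ⟨hu1, hu2⟩ := hout u hu
    obtain ⟨hv1, hv2⟩ := hout v hv
    simp only
    rw [dif_pos hu1, dif_pos hv1, hf' ⟨u, hu1⟩ ⟨v, hv1⟩ hu2 hv2 huv]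
  · intro i
    obtain ⟨⟨v, hv⟩, hvS, hvi⟩ := hs' (Fin.cast hq.symm i)
    refine ⟨v, ?_, ?_⟩
    · simp only [Finset.mem_union, not_or]
      refine ⟨hv, fun h => ?_⟩
      obtain ⟨w, hw, hwv⟩ := Finset.mem_map.1 h
      apply hvS
      convert hw
      exact hwv.symm
    · simp only
      rw [dif_pos hv, hvi]
      simp

/-! ### Consequences of connectivity, and distance two. -/

/-- The minimum degree of a `(k+1)`-connected graph is at least `k + 1`. -/
theorem IsKConnected.lt_minDegree {V : Type*} [Fintype V] {G : SimpleGraph V} [DecidableRel G.Adj]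
    {k : ℕ} (hconn : IsKConnected G (k + 1)) : k < G.minDegree := by
  classical
  have hn : k + 1 < Fintype.card V := hconn.1
  have : Nonempty V := Fintype.card_pos_iff.1 (by omega)
  obtain ⟨v, hv⟩ := G.exists_minimal_degree_vertex
  by_contra hlt
  have hc := hconn.2 (G.neighborFinset v) (by rw [SimpleGraph.card_neighborFinset_eq_degree]; omega)
  have hvN : v ∈ {w : V | w ∉ G.neighborFinset v} := by simp
  obtain ⟨w, hw⟩ : ∃ w, w ∉ insert v (G.neighborFinset v) := by
    by_contra h
    push Not at h
    have h1 : Fintype.card V ≤ (insert v (G.neighborFinset v)).card :=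
      Finset.card_le_card fun x _ => h x
    have h2 := Finset.card_insert_le v (G.neighborFinset v)
    rw [SimpleGraph.card_neighborFinset_eq_degree] at h2
    omega
  simp only [Finset.mem_insert, not_or] at hw
  -- Once its neighbours are deleted, `v` is isolated, so the indicator of `v` is constant along
  -- edges; yet it separates `v` from `w`.
  have := hc.map_eq_of_adj (fun x => decide (x.1 = v)) (fun x y h => by
    have h' : G.Adj x.1 y.1 := h
    have hx : ¬ G.Adj v x.1 := by simpa using x.2
    have hy : ¬ G.Adj v y.1 := by simpa using y.2
    have h1 : x.1 ≠ v := fun e => hy (by rwa [e] at h')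
    have h2 : y.1 ≠ v := fun e => hx (by rw [e] at h'; exact h'.symm)
    simp [h1, h2]) ⟨v, hvN⟩ ⟨w, hw.2⟩
  simp [hw.1] at this

theorem IsKConnected.connected {V : Type*} [Fintype V] {G : SimpleGraph V} {k : ℕ}
    (hconn : IsKConnected G (k + 1)) : G.Connected := by
  have h := hconn.2 ∅ (by simp)
  have e : {v : V | v ∉ (∅ : Finset V)} = Set.univ := by simp
  rw [e] at h
  exact (SimpleGraph.induceUnivIso G).connected_iff.1 h

theorem SimpleGraph.dist_eq_two {V : Type*} {G : SimpleGraph V} {u v w : V} (huv : u ≠ v)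
    (hadj : ¬ G.Adj u v) (huw : G.Adj u w) (hwv : G.Adj w v) : G.dist u v = 2 := by
  have h1 : G.dist u v ≤ 2 := SimpleGraph.dist_le (.cons huw (.cons hwv .nil))
  have h2 := (huw.reachable.trans hwv.reachable).pos_dist_of_ne huv
  have h3 : G.dist u v ≠ 1 := fun h => hadj (SimpleGraph.dist_eq_one_iff_adj.1 h)
  omega

/-! ### The Perron vector of the extremal graph. -/

section JoinCliqueIndep

variable {s m t : ℕ}

theorem joinCliqueIndep_adj_inl (i : Fin s) (x : Fin s ⊕ (Fin m ⊕ Fin t)) :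
    (joinCliqueIndep s m t).Adj (.inl i) x ↔ x ≠ .inl i := by
  rcases x with j | x
  · simp [joinCliqueIndep, graphJoin, eq_comm]
  · simp [joinCliqueIndep, graphJoin]

theorem joinCliqueIndep_adj_inr (x y : Fin m ⊕ Fin t) :
    (joinCliqueIndep s m t).Adj (.inr x) (.inr y) ↔ ∃ i j, x = .inl i ∧ y = .inl j ∧ i ≠ j := by
  rcases x with i | i <;> rcases y with j | j <;> simp [joinCliqueIndep, graphJoin]

theorem dist_joinCliqueIndep_inl (i : Fin s) (x : Fin s ⊕ (Fin m ⊕ Fin t)) :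
    ((joinCliqueIndep s m t).dist (.inl i) x : ℝ) = 1 - if x = .inl i then 1 else 0 := by
  by_cases h : x = .inl i
  · simp [h]
  · simp [h, SimpleGraph.dist_eq_one_iff_adj.2 ((joinCliqueIndep_adj_inl i x).2 h)]

theorem dist_joinCliqueIndep_inr_inl (i j : Fin m) :
    ((joinCliqueIndep s m t).dist (.inr (.inl i)) (.inr (.inl j)) : ℝ) =
      1 - if j = i then 1 else 0 := by
  by_cases h : j = i
  · simp [h]
  · rw [SimpleGraph.dist_eq_one_iff_adj.2
      ((joinCliqueIndep_adj_inr _ _).2 ⟨i, j, rfl, rfl, fun e => h e.symm⟩)]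
    simp [h]

theorem dist_joinCliqueIndep_inr_eq_two (hs : 0 < s) {x y : Fin m ⊕ Fin t} (hxy : x ≠ y)
    (h : ¬ ∃ i j, x = .inl i ∧ y = .inl j ∧ i ≠ j) :
    ((joinCliqueIndep s m t).dist (.inr x) (.inr y) : ℝ) = 2 := by
  have := SimpleGraph.dist_eq_two (G := joinCliqueIndep s m t) (u := .inr x) (v := .inr y)
    (w := .inl ⟨0, hs⟩) (by simpa using hxy) (by rwa [joinCliqueIndep_adj_inr])
    ((joinCliqueIndep_adj_inl _ _).2 (by simp)).symm ((joinCliqueIndep_adj_inl _ _).2 (by simp))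
  rw [this]
  norm_num

theorem dist_joinCliqueIndep_inr_inr (hs : 0 < s) (i : Fin m) (j : Fin t) :
    ((joinCliqueIndep s m t).dist (.inr (.inl i)) (.inr (.inr j)) : ℝ) = 2 :=
  dist_joinCliqueIndep_inr_eq_two hs (by simp) (by simp)

theorem dist_joinCliqueIndep_indep (hs : 0 < s) (i j : Fin t) :
    ((joinCliqueIndep s m t).dist (.inr (.inr i)) (.inr (.inr j)) : ℝ) =
      2 - if j = i then 2 else 0 := by
  by_cases h : j = i
  · simp [h]
  · rw [dist_joinCliqueIndep_inr_eq_two hs (by simpa using fun e => h e.symm) (by simp)]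
    simp [h]

theorem distSignlessLaplacian_mulVec_apply {V : Type*} [Fintype V] [DecidableEq V]
    (G : SimpleGraph V) (x : V → ℝ) (u : V) :
    (distSignlessLaplacian G).mulVec x u = ∑ v, (G.dist u v : ℝ) * (x u + x v) := by
  rw [distSignlessLaplacian, Matrix.add_mulVec, Pi.add_apply, Matrix.mulVec_diagonal,
    Matrix.mulVec, dotProduct, transmission, Finset.sum_mul, ← Finset.sum_add_distrib]
  refine Finset.sum_congr rfl fun v _ => ?_
  simp only [distMatrix, Matrix.of_apply]
  ring

/-- The Perron vector of `K_s ∨ (K_m ∪ t K₁)`, scaled to be `1` on `K_m`, is `a` on `K_s` and `r` on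
`t K₁`. -/
theorem exists_perron_joinCliqueIndep (hs : 0 < s) (hm : 0 < m) (ht : 0 < t) :
    ∃ a r : ℝ, 0 < a ∧ 0 < r ∧
      (distSignlessRadius (joinCliqueIndep s m t) - (s + m + t) + 2) * a = s * a + m + t * r ∧
      distSignlessRadius (joinCliqueIndep s m t) - (s + m + t) - t + 2 =
        s * a + m + t * r + t * r ∧
      (distSignlessRadius (joinCliqueIndep s m t) - (s + m + t) - m - t + 4) * r =
        s * a + m + t * r + m + t * r := by
  have : Nonempty (Fin s ⊕ (Fin m ⊕ Fin t)) := ⟨.inl ⟨0, hs⟩⟩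
  obtain ⟨w, hw0, hwne, hw⟩ := exists_nonneg_eigenvector (joinCliqueIndep s m t)
  set y := distSignlessRadius (joinCliqueIndep s m t) with hy
  set A1 := ∑ i, w (.inl i) with hA1
  set A2 := ∑ i, w (.inr (.inl i)) with hA2
  set A3 := ∑ i, w (.inr (.inr i)) with hA3
  have hrow := fun u => congrFun hw u
  simp only [distSignlessLaplacian_mulVec_apply, Fintype.sum_sum_type, Pi.smul_apply,
    smul_eq_mul] at hrow
  -- In each of the three row types the right side depends only on the part sums. Once it is known
  -- to be positive, the coefficient is nonzero and `w` is constant on each part.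
  have h1 : ∀ i, (y - (s + m + t) + 2) * w (.inl i) = A1 + A2 + A3 := by
    intro i
    have h := hrow (.inl i)
    simp only [dist_joinCliqueIndep_inl, sub_mul, Finset.sum_sub_distrib, one_mul, ite_mul,
      zero_mul, Sum.inl.injEq, Finset.sum_ite_eq', Finset.mem_univ, if_true, reduceCtorEq, if_false,
      Finset.sum_const_zero, Finset.sum_add_distrib, Finset.sum_const, Finset.card_univ,
      Fintype.card_fin, nsmul_eq_mul] at h
    linarith
  have h2 : ∀ i, (y - (s + m + t) - t + 2) * w (.inr (.inl i)) = A1 + A2 + A3 + A3 := by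
    intro i
    have h := hrow (.inr (.inl i))
    have hc1 : ∀ j, (joinCliqueIndep s m t).dist (.inr (.inl i)) (.inl j) =
        (joinCliqueIndep s m t).dist (.inl j) (.inr (.inl i)) := fun _ => SimpleGraph.dist_comm
    simp only [hc1] at h
    simp only [dist_joinCliqueIndep_inl, dist_joinCliqueIndep_inr_inl,
      dist_joinCliqueIndep_inr_inr hs, sub_mul, Finset.sum_sub_distrib, one_mul, ite_mul,
      zero_mul, Finset.sum_ite_eq', Finset.mem_univ, if_true, reduceCtorEq, if_false,
      Finset.sum_const_zero, Finset.sum_add_distrib, Finset.sum_const, Finset.card_univ,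
      Fintype.card_fin, nsmul_eq_mul, ← Finset.mul_sum] at h
    linarith
  have h3 : ∀ i, (y - (s + m + t) - m - t + 4) * w (.inr (.inr i)) =
      A1 + A2 + A3 + A2 + A3 := by
    intro i
    have h := hrow (.inr (.inr i))
    have hc1 : ∀ j, (joinCliqueIndep s m t).dist (.inr (.inr i)) (.inl j) =
        (joinCliqueIndep s m t).dist (.inl j) (.inr (.inr i)) := fun _ => SimpleGraph.dist_comm
    have hc2 : ∀ j, (joinCliqueIndep s m t).dist (.inr (.inr i)) (.inr (.inl j)) =
        (joinCliqueIndep s m t).dist (.inr (.inl j)) (.inr (.inr i)) :=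
      fun _ => SimpleGraph.dist_comm
    simp only [hc1, hc2] at h
    simp only [dist_joinCliqueIndep_inl, dist_joinCliqueIndep_indep hs,
      dist_joinCliqueIndep_inr_inr hs, sub_mul, Finset.sum_sub_distrib, one_mul, ite_mul,
      zero_mul, Finset.sum_ite_eq', Finset.mem_univ, if_true, reduceCtorEq, if_false,
      Finset.sum_const_zero, Finset.sum_add_distrib, Finset.sum_const, Finset.card_univ,
      Fintype.card_fin, nsmul_eq_mul, ← Finset.mul_sum] at h
    linarith
  have hA1n : 0 ≤ A1 := Finset.sum_nonneg fun i _ => hw0 _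
  have hA2n : 0 ≤ A2 := Finset.sum_nonneg fun i _ => hw0 _
  have hA3n : 0 ≤ A3 := Finset.sum_nonneg fun i _ => hw0 _
  have hT : 0 < A1 + A2 + A3 := by
    refine lt_of_le_of_ne (by positivity) fun h => hwne (funext fun x => ?_)
    have hx : w x ≤ A1 + A2 + A3 := by
      have : ∑ x, w x = A1 + A2 + A3 := by
        rw [Fintype.sum_sum_type, Fintype.sum_sum_type, ← add_assoc]
      rw [← this]
      exact Finset.single_le_sum (fun i _ => hw0 i) (Finset.mem_univ x)
    exact le_antisymm (hx.trans h.symm.le) (hw0 x)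
  have hpos : ∀ {c x B : ℝ}, c * x = B → 0 ≤ x → 0 < B → 0 < c ∧ 0 < x := by
    intro c x B h hx hB
    have hx' : 0 < x := lt_of_le_of_ne hx fun h0 => by rw [← h0, mul_zero] at h; linarith
    exact ⟨pos_of_mul_pos_left (h ▸ hB) hx, hx'⟩
  set w1 := w (.inl ⟨0, hs⟩) with hw1
  set w2 := w (.inr (.inl ⟨0, hm⟩)) with hw2
  set w3 := w (.inr (.inr ⟨0, ht⟩)) with hw3
  obtain ⟨hc1, hp1⟩ := hpos (h1 ⟨0, hs⟩) (hw0 _) hT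
  obtain ⟨hc2, hp2⟩ := hpos (h2 ⟨0, hm⟩) (hw0 _) (by linarith)
  obtain ⟨hc3, hp3⟩ := hpos (h3 ⟨0, ht⟩) (hw0 _) (by linarith)
  have e1 : A1 = s * w1 := by
    have : ∀ i, w (.inl i) = w1 := fun i =>
      mul_left_cancel₀ hc1.ne' ((h1 i).trans (h1 ⟨0, hs⟩).symm)
    rw [hA1]
    simp [this]
  have e2 : A2 = m * w2 := by
    have : ∀ i, w (.inr (.inl i)) = w2 := fun i =>
      mul_left_cancel₀ hc2.ne' ((h2 i).trans (h2 ⟨0, hm⟩).symm)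
    rw [hA2]
    simp [this]
  have e3 : A3 = t * w3 := by
    have : ∀ i, w (.inr (.inr i)) = w3 := fun i =>
      mul_left_cancel₀ hc3.ne' ((h3 i).trans (h3 ⟨0, ht⟩).symm)
    rw [hA3]
    simp [this]
  have k1 : _ * w1 = _ := h1 ⟨0, hs⟩
  have k2 : _ * w2 = _ := h2 ⟨0, hm⟩
  have k3 : _ * w3 = _ := h3 ⟨0, ht⟩
  have hw20 : w2 ≠ 0 := hp2.ne'
  rw [e1, e2, e3] at k1 k2 k3
  replace hp1 : 0 < w1 := hp1
  replace hp2 : 0 < w2 := hp2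
  replace hp3 : 0 < w3 := hp3
  clear_value w1 w2 w3
  refine ⟨w1 / w2, w3 / w2, div_pos hp1 hp2, div_pos hp3 hp2, ?_, ?_, ?_⟩
  · field_simp
    linarith
  · field_simp
    linarith
  · field_simp
    linarith

end JoinCliqueIndep

/-! ### Contribution of the pairs separated by `S`. -/

/-- Half the sum of `(x u + x v) ^ 2` over the ordered pairs of vertices outside `S` that lie in
different classes of `f`, see `sum_separated`. -/
noncomputable def sepForm {V ι : Type*} [Fintype V] [DecidableEq V] [Fintype ι] [DecidableEq ι]
    (S : Finset V) (f : V → ι) (x : V → ℝ) : ℝ :=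
  (Sᶜ.card : ℝ) * ∑ v ∈ Sᶜ, x v ^ 2 + (∑ v ∈ Sᶜ, x v) ^ 2 -
    ∑ i, (((Sᶜ.filter fun v => f v = i).card : ℝ) * ∑ v ∈ Sᶜ.filter fun v => f v = i, x v ^ 2 +
      (∑ v ∈ Sᶜ.filter fun v => f v = i, x v) ^ 2)

theorem sum_sum_add_sq {V : Type*} (B : Finset V) (x : V → ℝ) :
    ∑ u ∈ B, ∑ v ∈ B, (x u + x v) ^ 2 =
      2 * ((B.card : ℝ) * ∑ v ∈ B, x v ^ 2 + (∑ v ∈ B, x v) ^ 2) := by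
  have e : ∀ u, ∑ v ∈ B, (x u + x v) ^ 2 =
      B.card * x u ^ 2 + 2 * x u * ∑ v ∈ B, x v + ∑ v ∈ B, x v ^ 2 := by
    intro u
    rw [Finset.mul_sum, ← nsmul_eq_mul, ← Finset.sum_const, ← Finset.sum_add_distrib,
      ← Finset.sum_add_distrib]
    exact Finset.sum_congr rfl fun v _ => by ring
  simp only [e, Finset.sum_add_distrib, ← Finset.mul_sum, ← Finset.sum_mul, Finset.sum_const,
    nsmul_eq_mul]
  ring

section Separated

variable {V ι : Type*} [Fintype V] [DecidableEq V] [Fintype ι] [DecidableEq ι]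

theorem sum_separated (S : Finset V) (f : V → ι) (x : V → ℝ) :
    ∑ u ∈ Sᶜ, ∑ v ∈ Sᶜ, (if f u ≠ f v then (x u + x v) ^ 2 else 0) = 2 * sepForm S f x := by
  have e1 : ∀ u v, (if f u ≠ f v then (x u + x v) ^ 2 else 0) =
      (x u + x v) ^ 2 - if f v = f u then (x u + x v) ^ 2 else 0 := by
    intro u v
    by_cases h : f u = f v
    · simp [h]
    · simp [h, Ne.symm h]
  have e2 : ∑ u ∈ Sᶜ, ∑ v ∈ Sᶜ, (if f v = f u then (x u + x v) ^ 2 else 0) =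
      ∑ i, ∑ u ∈ Sᶜ.filter fun v => f v = i, ∑ v ∈ Sᶜ.filter fun v => f v = i,
        (x u + x v) ^ 2 := by
    rw [← Finset.sum_fiberwise Sᶜ f]
    refine Finset.sum_congr rfl fun i _ => Finset.sum_congr rfl fun u hu => ?_
    rw [← Finset.sum_filter, (Finset.mem_filter.1 hu).2]
  simp only [e1, Finset.sum_sub_distrib]
  rw [e2, sum_sum_add_sq]
  simp only [sum_sum_add_sq, ← Finset.mul_sum]
  rw [sepForm]
  ring

-- Vertices in different classes are nonadjacent. The set `P` collects further nonadjacent pairs,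
-- which are disjoint from the separated ones; a single such pair makes the Rayleigh bound strict,
-- as the equality case requires.
open Classical in
theorem sum_separated_le {G : SimpleGraph V} {S : Finset V} {f : V → ι}
    (hf : ∀ u v, u ∉ S → v ∉ S → G.Adj u v → f u = f v) (x : V → ℝ) (P : Finset (V × V))
    (hP : ∀ e ∈ P, e.1 ≠ e.2 ∧ ¬ G.Adj e.1 e.2 ∧ (e.1 ∈ S ∨ e.2 ∈ S ∨ f e.1 = f e.2)) :
    2 * sepForm S f x + ∑ e ∈ P, (x e.1 + x e.2) ^ 2 ≤
      ∑ u, ∑ v, (if u ≠ v ∧ ¬ G.Adj u v then (x u + x v) ^ 2 else 0) := by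
  rw [← sum_separated, ← Finset.sum_product', ← Finset.sum_product', ← Finset.sum_filter,
    ← Finset.sum_filter, ← Finset.sum_union]
  · refine Finset.sum_le_sum_of_subset_of_nonneg ?_ fun _ _ _ => sq_nonneg _
    rintro ⟨u, v⟩ h
    simp only [Finset.mem_union, Finset.mem_filter, Finset.mem_product, Finset.mem_compl,
      Finset.mem_univ, true_and, and_true] at h ⊢
    rcases h with ⟨⟨hu, hv⟩, huv⟩ | h
    · exact ⟨fun e => huv (e ▸ rfl), fun ha => huv (hf u v hu hv ha)⟩
    · exact ⟨(hP _ h).1, (hP _ h).2.1⟩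
  · rw [Finset.disjoint_left]
    rintro ⟨u, v⟩ h h'
    simp only [Finset.mem_filter, Finset.mem_product, Finset.mem_compl] at h
    rcases (hP _ h').2.2 with h1 | h1 | h1
    · exact h.1.1 h1
    · exact h.1.2 h1
    · exact h.2 h1

theorem rayleigh_separated {G : SimpleGraph V} (hG : G.Connected) {S : Finset V} {f : V → ι}
    (hf : ∀ u v, u ∉ S → v ∉ S → G.Adj u v → f u = f v) (x : V → ℝ) :
    ((Fintype.card V : ℝ) - 2) * ∑ v, x v ^ 2 + (∑ v, x v) ^ 2 + sepForm S f x ≤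
      distSignlessRadius G * ∑ v, x v ^ 2 := by
  have h1 := rayleigh_nonadj hG x
  have h2 := sum_separated_le hf x ∅ (by simp)
  rw [Finset.sum_empty] at h2
  linarith

theorem rayleigh_separated_lt {G : SimpleGraph V} (hG : G.Connected) {S : Finset V} {f : V → ι}
    (hf : ∀ u v, u ∉ S → v ∉ S → G.Adj u v → f u = f v) (x : V → ℝ) {u₀ v₀ : V} (hne : u₀ ≠ v₀)
    (hadj : ¬ G.Adj u₀ v₀) (hsep : u₀ ∈ S ∨ v₀ ∈ S ∨ f u₀ = f v₀) (hx : 0 < x u₀ + x v₀) :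
    ((Fintype.card V : ℝ) - 2) * ∑ v, x v ^ 2 + (∑ v, x v) ^ 2 + sepForm S f x <
      distSignlessRadius G * ∑ v, x v ^ 2 := by
  have h1 := rayleigh_nonadj hG x
  have h2 := sum_separated_le hf x {(u₀, v₀)} (by
    intro e he
    rw [Finset.mem_singleton] at he
    subst he
    exact ⟨hne, hadj, hsep⟩)
  rw [Finset.sum_singleton] at h2
  have h3 : 0 < (x u₀ + x v₀) ^ 2 := by positivity
  linarith

end Separated

/-! ### Test vectors with three values. -/

section ThreeValued

variable {V : Type*} [DecidableEq V]

/-- The vector with value `a` on `A`, `r` on `I` and `o` elsewhere. -/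
def threeValued (A I : Finset V) (a r o : ℝ) (v : V) : ℝ :=
  if v ∈ A then a else if v ∈ I then r else o

theorem sum_threeValued {A I : Finset V} (hAI : Disjoint A I) (a r o : ℝ) (B : Finset V) :
    ∑ v ∈ B, threeValued A I a r o v =
      (B ∩ A).card * a + (B ∩ I).card * r + (B \ (A ∪ I)).card * o := by
  have h1 : ∀ v, threeValued A I a r o v =
      (if v ∈ A then a else 0) + (if v ∈ I then r else 0) + if v ∉ A ∪ I then o else 0 := by
    intro v
    have : v ∈ A → v ∉ I := fun h => Finset.disjoint_left.1 hAI h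
    by_cases hA : v ∈ A <;> by_cases hI : v ∈ I <;> simp_all [threeValued]
  simp only [h1, Finset.sum_add_distrib, ← Finset.sum_filter, Finset.sum_const, nsmul_eq_mul]
  rw [Finset.filter_mem_eq_inter, Finset.filter_mem_eq_inter, ← Finset.sdiff_eq_filter]

theorem threeValued_sq (A I : Finset V) (a r o : ℝ) (v : V) :
    threeValued A I a r o v ^ 2 = threeValued A I (a ^ 2) (r ^ 2) (o ^ 2) v := by
  unfold threeValued
  split_ifs <;> rfl

theorem card_eq_inter_add_inter_add_sdiff {A I : Finset V} (hAI : Disjoint A I) (B : Finset V) :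
    (B.card : ℝ) = (B ∩ A).card + (B ∩ I).card + (B \ (A ∪ I)).card := by
  have h := sum_threeValued hAI 1 1 1 B
  have e : ∀ v, threeValued A I 1 1 1 v = 1 := fun v => by unfold threeValued; split_ifs <;> rfl
  simpa [e] using h

end ThreeValued

/-! ### Scalar inequalities for the Perron values. -/

section PerronScalars

variable {d m p a r y : ℝ}

/-- The Perron values of `K_d ∨ (K_m ∪ p K₁)`: `a` on `K_d`, `1` on `K_m` and `r` on `p K₁`, with
eigenvalue `y`. -/
structure IsPerronTriple (d m p a r y : ℝ) : Prop where
  a_pos : 0 < a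
  r_pos : 0 < r
  eq_a : (y - (d + m + p) + 2) * a = d * a + m + p * r
  eq_one : y - (d + m + p) - p + 2 = d * a + m + p * r + p * r
  eq_r : (y - (d + m + p) - m - p + 4) * r = d * a + m + p * r + m + p * r

namespace IsPerronTriple

/-- Each row is weighted by its entry and its multiplicity. The last bracket is the sum of `(x u + x
v)²` over unordered nonadjacent pairs: `2p(p-1)r²` inside `p K₁`, and `pm(1+r)²` between `K_m` and
`p K₁`. -/
theorem rayleigh (h : IsPerronTriple d m p a r y) :
    y * (d * a ^ 2 + m + p * r ^ 2) =
      (d + m + p - 2) * (d * a ^ 2 + m + p * r ^ 2) + (d * a + m + p * r) ^ 2 +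
        (2 * p ^ 2 * r ^ 2 + p * m * (1 + r) ^ 2 - 2 * p * r ^ 2) := by
  linear_combination d * a * h.eq_a + m * h.eq_one + p * r * h.eq_r

/-- Eliminating `y` between the rows of `p K₁` and `K_m` leaves the relation that controls `r`, both
`1 ≤ r` and the upper bound of order `√(m/p)` in `quadratic_le`. -/
theorem balance (h : IsPerronTriple d m p a r y) :
    (d * a + 2 * p * r) * (r - 1) = 2 * (m - r) := by
  linear_combination h.eq_r - r * h.eq_one

theorem one_le_r (h : IsPerronTriple d m p a r y) (hd : 0 < d) (hp : 0 < p) (hm : 1 ≤ m) :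
    1 ≤ r := by
  by_contra hr
  push Not at hr
  have h1 := h.balance
  have h2 := h.a_pos
  have h3 := h.r_pos
  have h4 : 0 < (d * a + 2 * p * r) * (1 - r) := mul_pos (by positivity) (by linarith)
  nlinarith

theorem quadratic_le (h : IsPerronTriple d m p a r y) (hd : 0 < d) (hp : 0 < p) (hm : 1 ≤ m) :
    p * (r ^ 2 - r) + r ≤ m := by
  have h1 := h.balance
  have h2 : 0 ≤ d * a * (r - 1) :=
    mul_nonneg (mul_nonneg hd.le h.a_pos.le) (by linarith [h.one_le_r hd hp hm])
  nlinarith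

/-- Eliminating `y` between the first two rows shows `a = X / (X + pr + p)` with `X = da + m + pr`.
All bounds on `a` come from this. -/
theorem a_mul (h : IsPerronTriple d m p a r y) :
    a * (d * a + m + p * r + p * r + p) = d * a + m + p * r := by
  linear_combination h.eq_a - a * h.eq_one

theorem a_le_one (h : IsPerronTriple d m p a r y) (hd : 0 < d) (hp : 0 < p) (hm : 1 ≤ m) :
    a ≤ 1 := by
  have h1 := h.a_mul
  have h2 := h.a_pos
  have h3 := h.r_pos
  have h4 : 0 < d * a + m + p * r := by positivity
  by_contra h5
  push Not at h5
  nlinarith [mul_pos hp h3, mul_pos (mul_pos hp h3) h2, mul_pos hp h2]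

theorem half_le_a (h : IsPerronTriple d m p a r y) (hd : 0 < d) (hp : 0 < p) (hm : 1 ≤ m)
    (hpm : p ≤ m) : 1 / 2 ≤ a := by
  have h1 := h.a_mul
  have h2 := h.a_pos
  have h3 := h.r_pos
  have h4 : 0 < d * a := by positivity
  have h5 : 0 < p * r := by positivity
  have h6 : 0 < d * a + m + p * r + p * r + p := by positivity
  by_contra h7
  push Not at h7
  have h8 := mul_lt_mul_of_pos_right h7 h6
  linarith

theorem three_quarters_le_a (h : IsPerronTriple d m p a r y) (hd : 0 < d) (hp : 0 < p) (hm : 1 ≤ m)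
    (hpm : 2 * (p * r) + 3 * p ≤ m) : 3 / 4 ≤ a := by
  have h1 := h.a_mul
  have h2 := h.a_pos
  have h3 := h.r_pos
  have h4 : 0 < d * a := by positivity
  have h5 : 0 < p * r := by positivity
  have h6 : 0 < d * a + m + p * r + p * r + p := by positivity
  by_contra h7
  push Not at h7
  have h8 := mul_lt_mul_of_pos_right h7 h6
  linarith

theorem y_le (h : IsPerronTriple d m p a r y) (hd : 0 < d) (hp : 0 < p) (hm : 1 ≤ m) :
    y ≤ 2 * (d + m + p) - 2 + 2 * (p * r) := by
  have h1 := h.eq_one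
  have h2 := mul_le_mul_of_nonneg_left (h.a_le_one hd hp hm) hd.le
  linarith

end IsPerronTriple

/-- Twice `hq` plus `hpm` leaves the surplus `p(r-2)² + 2r`. -/
theorem mul_one_add_sq_le (hp : 0 < p) (hr : 0 < r) (hq : p * (r ^ 2 - r) + r ≤ m)
    (hpm : 5 * p ≤ m) : p * (1 + r) ^ 2 ≤ 3 * m := by
  nlinarith [mul_nonneg hp.le (sq_nonneg (r - 2))]

/-- The leading constant drops from `3` to `3/2`, at the price of a term linear in `p`; the case `b
= 1` needs this, and there `6p² ≤ m` absorbs that term. -/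
theorem two_mul_mul_one_add_sq_le (hp : 2 ≤ p) (hq : p * (r ^ 2 - r) + r ≤ m) :
    2 * (p * (1 + r) ^ 2) ≤ 3 * m + 15 * p - 9 := by
  have h1 : 0 < r ^ 2 - 7 * r + 13 := by nlinarith [sq_nonneg (2 * r - 7)]
  nlinarith [mul_le_mul_of_nonneg_right hp h1.le, sq_nonneg (4 * r - 11)]

/-- The excess of `K_s ∨ (K_{n-2s} ∪ s K₁)` on the vector that is `1` on `K_s` and `2` elsewhere. -/
theorem excess_pos {n s g : ℝ} (hd : 2 ≤ d) (hn : 6 * d ^ 2 + 2 * d + 2 ≤ n)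
    (hg : g ≤ n / 4 + 457 / 100 * d - 1) (hs₀ : n / 8 + 3 / 4 * d ≤ s) (hs₁ : s ≤ (n - 1) / 2) :
    g * (4 * n - 3 * s) < s * (15 * n - 23 * s - 8) := by
  have hn15 : 15 * d ≤ n := by nlinarith
  have hlin : ∀ s₀ s₁ c₀ c₁ : ℝ, s₀ ≤ s → s ≤ s₁ → 0 < c₀ + c₁ * s₀ → 0 < c₀ + c₁ * s₁ →
      0 < c₀ + c₁ * s := by
    intro s₀ s₁ c₀ c₁ h0 h1 e0 e1
    rcases le_total 0 c₁ with h | h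
    · nlinarith [mul_le_mul_of_nonneg_left h0 h]
    · nlinarith [mul_le_mul_of_nonpos_left h1 h]
  -- The difference of the two sides is concave in `s`. Replacing `s²` by its chord between the two
  -- endpoints makes it affine, so the endpoint checks `h0` and `h1` suffice.
  have hconv : 0 ≤ (s - (n / 8 + 3 / 4 * d)) * ((n - 1) / 2 - s) :=
    mul_nonneg (by linarith) (by linarith)
  have h0 : g * (4 * n - 3 * (n / 8 + 3 / 4 * d)) <
      (n / 8 + 3 / 4 * d) * (15 * n - 23 * (n / 8 + 3 / 4 * d) - 8) := by
    refine lt_of_le_of_lt (mul_le_mul_of_nonneg_right hg (by nlinarith)) ?_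
    nlinarith [mul_nonneg (sub_nonneg.2 hn15) (by linarith : (0 : ℝ) ≤ n),
      mul_nonneg (sub_nonneg.2 hn15) (by linarith : (0 : ℝ) ≤ d)]
  have h1 : g * (4 * n - 3 * ((n - 1) / 2)) <
      (n - 1) / 2 * (15 * n - 23 * ((n - 1) / 2) - 8) := by
    have hg' : g ≤ 56 / 100 * n - 1 := by linarith
    refine lt_of_le_of_lt (mul_le_mul_of_nonneg_right hg' (by linarith)) ?_
    nlinarith
  have := hlin (n / 8 + 3 / 4 * d) ((n - 1) / 2)
    (23 * ((n / 8 + 3 / 4 * d) * ((n - 1) / 2)) - 4 * n * g)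
    (15 * n - 8 - 23 * (n / 8 + 3 / 4 * d + (n - 1) / 2) + 3 * g) hs₀ hs₁
    (by linarith) (by linarith)
  linarith

/-- A linearisation of `r ≲ √(n/d)`: a quarter of `hq` is used, and `457/100` makes the remaining
quadratic in `r` positive at `d = 2`. It bounds the excess of `y` over `2n - 2`. -/
theorem two_mul_mul_le {n : ℝ} (hd : 2 ≤ d) (hq : d * (r ^ 2 - r) + r ≤ n - 2 * d) :
    2 * (d * r) ≤ n / 4 + 457 / 100 * d - 1 := by
  have h1 : 0 < r ^ 2 / 4 - 9 / 4 * r + 507 / 100 := by nlinarith [sq_nonneg (2 * r - 9)]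
  nlinarith [mul_le_mul_of_nonneg_right hd h1.le, sq_nonneg (4 * r - 17)]

/-- With few more separator vertices than in the extremal graph, the gain exceeds the loss; `b ≥ 3`. -/
theorem gain_le_loss_of_three_le {W t N A R b : ℝ} (hm : 0 < m) (hb : 3 ≤ b) (hp : 4 ≤ p)
    (hW : p * W ≤ 3 * m) (ht : 0 ≤ t) (hR : 0 ≤ R) (hN : N = m - t) (htm : (b + 1) * t ≤ m)
    (hA : R + b * t ≤ A) (hle : 2 * (N * A) ≤ W * (p * t + R)) : A = 0 ∧ t = 0 := by
  have hW' : 4 * W ≤ 3 * m := by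
    rcases le_total 0 W with h | h
    · nlinarith
    · nlinarith
  -- Here `4t ≤ m`, so the gain is at least `(3/2)mA`, while the loss is at most `m(3t + (3/4)R)`;
  -- since `A ≥ R + 3t`, only zero is possible.
  have h1 : 3 / 4 * m ≤ N := by nlinarith
  have hbt : 3 * t ≤ b * t := mul_le_mul_of_nonneg_right hb ht
  have hA0 : 0 ≤ A := by nlinarith
  have h2 := mul_le_mul_of_nonneg_right h1 hA0
  have h3 := mul_le_mul_of_nonneg_right hW ht
  have h4 := mul_le_mul_of_nonneg_right hW' hR
  have h5 : m * (3 / 2 * A - 3 * t - 3 / 4 * R) ≤ 0 := by nlinarith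
  have h6 : 3 / 2 * A - 3 * t - 3 / 4 * R ≤ 0 := by
    by_contra h
    push Not at h
    nlinarith [mul_pos hm h]
  constructor <;> linarith

/-- The analogue of `gain_le_loss_of_three_le` for `b = 1`. -/
theorem gain_le_loss_of_one {W t N A R : ℝ} (hm : 0 < m) (hp : 2 ≤ p)
    (hW : p * W ≤ 2 * m) (ht : 0 ≤ t) (hR : 0 ≤ R) (hN : N = m - t) (htm : 8 * t ≤ m)
    (hA : R + t ≤ A) (hle : 2 * (N * A) ≤ W * (p * t + R))
    (hle' : 4 * (A * (N - A)) ≤ W * (p * t + R)) : A = 0 ∧ t = 0 := by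
  have hW' : W ≤ m := by
    rcases le_total 0 W with h | h
    · nlinarith
    · linarith
  have hA0 : 0 ≤ A := by linarith
  have h3 := mul_le_mul_of_nonneg_right hW ht
  have h4 := mul_le_mul_of_nonneg_right hW' hR
  have hloss : W * (p * t + R) ≤ m * (2 * t + R) := by nlinarith
  -- By `R + t ≤ A` the loss is at most `m(t + A)`. If `2t ≤ A`, this is at most `(3/2)mA` against a
  -- gain of `(7/4)mA`; otherwise it is at most `2mA` against `(5/2)mA`, from the second estimate of
  -- the gain.
  have key : m * (1 / 4 * A) ≤ 0 := by
    rcases le_total (2 * t) A with h | h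
    · have h1 : 7 / 8 * m ≤ N := by linarith
      have h2 := mul_le_mul_of_nonneg_right h1 hA0
      nlinarith
    · have h1 : 5 / 8 * m ≤ N - A := by linarith
      have h2 := mul_le_mul_of_nonneg_left h1 hA0
      nlinarith
  have hA1 : A ≤ 0 := by
    by_contra h
    push Not at h
    nlinarith [mul_pos hm h]
  constructor <;> linarith

/-- Separators smaller than in the extremal graph, `b ≥ 3`. -/
theorem small_separator_gain_of_three_le {t R : ℝ} (hm : 1 ≤ m) (hr : 1 ≤ r) (ha : 1 / 2 ≤ a)
    (hp : 3 * (t + 1) < p) (ht : 1 ≤ t) (hR : t ≤ R) (hq : p * (r ^ 2 - r) + r ≤ m)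
    (hW : p * (1 + r) ^ 2 ≤ 3 * m) :
    0 < p * t * (r + a) ^ 2 + 2 * m * R - 2 * r ^ 2 * t * p - (1 + r) ^ 2 * (t + 1) * R := by
  have hW0 : (0 : ℝ) ≤ (1 + r) ^ 2 := sq_nonneg _
  -- Half of the gain `2mR` pays for the last loss. The other half is at least `mt`, which with `a ≥
  -- 1/2` and `hq` leaves at least `tr`.
  have h1 : (1 + r) ^ 2 * (t + 1) ≤ m := by nlinarith
  have h2 : m * t ≤ m * R := mul_le_mul_of_nonneg_left hR (by linarith)
  have h3 : (1 + r) ^ 2 * (t + 1) * R ≤ m * R := mul_le_mul_of_nonneg_right h1 (by linarith)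
  have hpt : 0 < p * t := mul_pos (by linarith) (by linarith)
  have h4 : p * t * (r ^ 2 + r) ≤ p * t * (r + a) ^ 2 :=
    mul_le_mul_of_nonneg_left (by nlinarith) hpt.le
  have h5 := mul_le_mul_of_nonneg_right hq (by linarith : 0 ≤ t)
  nlinarith

/-- Separators smaller than in the extremal graph, `b = 1`, at least four components. -/
theorem small_separator_gain_of_one {t R : ℝ} (hr : 1 ≤ r) (ha : 1 / 2 ≤ a)
    (hp : t + 3 ≤ p) (ht : 1 ≤ t) (hR : 2 * t ≤ R) (hq : p * (r ^ 2 - r) + r ≤ m)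
    (hpm : 6 * p ^ 2 ≤ m) :
    0 < p * t * (r + a) ^ 2 + 2 * m * R - 2 * r ^ 2 * t * p - (1 + r) ^ 2 * (t + 1) * R := by
  have hW := two_mul_mul_one_add_sq_le (by linarith) hq
  have hW0 : (0 : ℝ) ≤ (1 + r) ^ 2 := sq_nonneg _
  have hp2 : 0 ≤ p - 2 := by linarith
  -- The factor `p - 2` instead of `p` makes room for the lower-order terms of `hW`. Since `t + 1 ≤
  -- p - 2`, a quarter of `2mR` is left over, and `R ≥ 2t` turns it into `mt`.
  have hW1 : 2 * ((1 + r) ^ 2 * (p - 2)) ≤ 3 * m := by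
    have h := mul_le_mul_of_nonneg_right hW hp2
    have h' : p * (2 * ((1 + r) ^ 2 * (p - 2))) ≤ p * (3 * m) := by nlinarith
    exact le_of_mul_le_mul_left h' (by linarith)
  have h1 : 2 * ((1 + r) ^ 2 * (t + 1)) ≤ 3 * m := by
    have := mul_le_mul_of_nonneg_left (by linarith : t + 1 ≤ p - 2) hW0
    linarith
  have hm : 0 ≤ m := by nlinarith
  have h2 : m * (2 * t) ≤ m * R := mul_le_mul_of_nonneg_left hR hm
  have h3 : 2 * ((1 + r) ^ 2 * (t + 1)) * R ≤ 3 * m * R :=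
    mul_le_mul_of_nonneg_right h1 (by linarith)
  have hpt : 0 < p * t := mul_pos (by linarith) (by linarith)
  have h4 : p * t * (r ^ 2 + r) ≤ p * t * (r + a) ^ 2 :=
    mul_le_mul_of_nonneg_left (by nlinarith) hpt.le
  have h5 := mul_le_mul_of_nonneg_right hq (by linarith : 0 ≤ t)
  nlinarith

/-- Separators smaller than in the extremal graph, `b = 1`, three components, `t ≥ 2`. -/
theorem small_separator_gain_of_two_le {t R κ : ℝ} (hr : 1 ≤ r) (ha : 1 / 2 ≤ a)
    (hp : p = t + 2) (ht : 2 ≤ t) (hκ : 2 * κ ≤ t + 1) (hR : t ≤ R)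
    (hq : p * (r ^ 2 - r) + r ≤ m) (hpm : 6 * p ^ 2 ≤ m) :
    0 < p * t * (r + a) ^ 2 + 2 * m * R - 2 * r ^ 2 * κ * p - (1 + r) ^ 2 * (κ + 1) * R := by
  have hW := two_mul_mul_one_add_sq_le (by linarith) hq
  have hW0 : (0 : ℝ) ≤ (1 + r) ^ 2 := sq_nonneg _
  have hm : 0 < m := by nlinarith
  have hpW : p * (1 + r) ^ 2 ≤ 2 * m := by nlinarith
  have hW4 : 4 * (1 + r) ^ 2 ≤ 2 * m := by nlinarith
  have h1 : (1 + r) ^ 2 * (κ + 1) ≤ 5 / 4 * m := by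
    have := mul_le_mul_of_nonneg_left (by linarith : κ + 1 ≤ (p + 1) / 2) hW0
    nlinarith
  have h2 : m * 2 ≤ m * R := mul_le_mul_of_nonneg_left (by linarith) hm.le
  have h3 : (1 + r) ^ 2 * (κ + 1) * R ≤ 5 / 4 * m * R :=
    mul_le_mul_of_nonneg_right h1 (by linarith)
  have hpt : 0 < p * t := mul_pos (by linarith) (by linarith)
  have h4 : p * t * (r ^ 2 + r) ≤ p * t * (r + a) ^ 2 :=
    mul_le_mul_of_nonneg_left (by nlinarith) hpt.le
  have hp0 : 0 < p := by linarith
  have h5 : 2 * κ * (r ^ 2 * p) ≤ (t + 1) * (r ^ 2 * p) :=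
    mul_le_mul_of_nonneg_right hκ (by positivity)
  have h6 : 1 * (p * r) ≤ t * (p * r) := mul_le_mul_of_nonneg_right (by linarith) (by positivity)
  nlinarith

/-- Separators of two vertices when the extremal graph has three, `b = 1`. -/
theorem small_separator_gain_of_eq_one {R : ℝ} (hr : 1 ≤ r) (ha : 3 / 4 ≤ a) (hR : 1 ≤ R)
    (hq : 3 * (r ^ 2 - r) + r ≤ m) (hm : 56 ≤ m) :
    0 < 3 * 1 * (r + a) ^ 2 + 2 * m * R - 2 * r ^ 2 * 1 * 3 - (1 + r) ^ 2 * (1 + 1) * R := by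
  have hW := two_mul_mul_one_add_sq_le (by norm_num) hq
  have h1 : 0 ≤ 2 * m - 2 * (1 + r) ^ 2 := by linarith
  have h2 := mul_le_mul_of_nonneg_left hR h1
  have h3 : (r + 3 / 4) ^ 2 ≤ (r + a) ^ 2 := by nlinarith
  have h4 : 17 / 2 * r + 1 < m := by
    by_contra h
    push Not at h
    have : 6 ≤ r := by linarith
    nlinarith
  nlinarith

end PerronScalars

/-! ### Transplanting the Perron vector onto a separated graph. -/

/-- The class of `i` under `f` outside `S`. -/
def sepClass {V ι : Type*} [Fintype V] [DecidableEq V] [DecidableEq ι] (S : Finset V) (f : V → ι)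
    (i : ι) : Finset V :=
  Sᶜ.filter fun v => f v = i

theorem mem_sepClass {V ι : Type*} [Fintype V] [DecidableEq V] [DecidableEq ι]
    {S : Finset V} {f : V → ι} {i : ι} {v : V} :
    v ∈ sepClass S f i ↔ v ∉ S ∧ f v = i := by
  simp [sepClass]

theorem sum_mul_le_mul_sum_of_le {ι : Type*} {s : Finset ι} {c μ : ι → ℝ} {K : ℝ}
    (hc : ∀ i ∈ s, c i ≤ K) (hμ : ∀ i ∈ s, 0 ≤ μ i) : ∑ i ∈ s, c i * μ i ≤ K * ∑ i ∈ s, μ i := by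
  rw [Finset.mul_sum]
  exact Finset.sum_le_sum fun i hi => mul_le_mul_of_nonneg_right (hc i hi) (hμ i hi)

section Comparison

variable {V ι : Type*} [Fintype V] [DecidableEq V] [Fintype ι] [DecidableEq ι]

theorem sum_card_sepClass_inter (S : Finset V) (f : V → ι) (I : Finset V) (hI : Disjoint S I) :
    ∑ i, (sepClass S f i ∩ I).card = I.card := by
  rw [Finset.card_eq_sum_card_fiberwise (f := f) (t := Finset.univ) (by simp)]
  refine Finset.sum_congr rfl fun i _ => ?_
  congr 1
  ext v
  have : v ∈ I → v ∉ S := fun h h' => Finset.disjoint_left.1 hI h' h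
  simp only [Finset.mem_inter, mem_sepClass, Finset.mem_filter]
  tauto

theorem sum_card_sepClass (S : Finset V) (f : V → ι) :
    ∑ i, (sepClass S f i).card = Sᶜ.card := by
  rw [Finset.card_eq_sum_card_fiberwise (f := f) (t := Finset.univ) (by simp)]
  rfl

/-- Only the numbers `α i`, `c i`, `μ i` of vertices with values `a`, `r`, `1` in each class matter,
so graph data reduces to arithmetic. -/
theorem sepForm_threeValued (S : Finset V) (f : V → ι) {A I : Finset V} (hAI : Disjoint A I)
    (a r : ℝ) {α c μ : ι → ℝ} (hα : ∀ i, ((sepClass S f i ∩ A).card : ℝ) = α i)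
    (hc : ∀ i, ((sepClass S f i ∩ I).card : ℝ) = c i)
    (hμ : ∀ i, ((sepClass S f i).card : ℝ) = α i + c i + μ i) :
    sepForm S f (threeValued A I a r 1) =
      (∑ i, α i + ∑ i, c i + ∑ i, μ i) * ((∑ i, α i) * a ^ 2 + (∑ i, c i) * r ^ 2 + ∑ i, μ i) +
        ((∑ i, α i) * a + (∑ i, c i) * r + ∑ i, μ i) ^ 2 -
      ∑ i, ((α i + c i + μ i) * (α i * a ^ 2 + c i * r ^ 2 + μ i) +
        (α i * a + c i * r + μ i) ^ 2) := by
  have hμ' : ∀ i, ((sepClass S f i \ (A ∪ I)).card : ℝ) = μ i := fun i => by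
    have := card_eq_inter_add_inter_add_sdiff hAI (sepClass S f i)
    rw [hμ, hα, hc] at this
    linarith
  have hx : ∀ i, ∑ v ∈ sepClass S f i, threeValued A I a r 1 v = α i * a + c i * r + μ i := by
    intro i
    rw [sum_threeValued hAI, hα, hc, hμ', mul_one]
  have hx2 : ∀ i, ∑ v ∈ sepClass S f i, threeValued A I a r 1 v ^ 2 =
      α i * a ^ 2 + c i * r ^ 2 + μ i := by
    intro i
    simp only [threeValued_sq]
    rw [sum_threeValued hAI, hα, hc, hμ', one_pow, mul_one]
  have hfib : ∀ g : V → ℝ, ∑ v ∈ Sᶜ, g v = ∑ i, ∑ v ∈ sepClass S f i, g v := fun g =>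
    (Finset.sum_fiberwise Sᶜ f g).symm
  have hcard : (Sᶜ.card : ℝ) = ∑ i, (α i + c i + μ i) := by
    rw [← sum_card_sepClass S f]
    push_cast
    exact Finset.sum_congr rfl fun i _ => hμ i
  rw [sepForm, hfib, hfib, hcard]
  change _ - ∑ i, (((sepClass S f i).card : ℝ) *
    ∑ v ∈ sepClass S f i, threeValued A I a r 1 v ^ 2 +
      (∑ v ∈ sepClass S f i, threeValued A I a r 1 v) ^ 2) = _
  simp only [hx, hx2, hμ, Finset.sum_add_distrib, Finset.sum_mul]

theorem sum_univ_threeValued {A I : Finset V} (hAI : Disjoint A I) (a r : ℝ) {d p : ℕ} {m : ℝ}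
    (hA : A.card = d) (hI : I.card = p) (hV : (Fintype.card V : ℝ) = d + m + p) :
    ∑ v, threeValued A I a r 1 v = d * a + m + p * r := by
  have h := card_eq_inter_add_inter_add_sdiff hAI Finset.univ
  rw [sum_threeValued hAI]
  rw [Finset.card_univ, hV] at h
  simp only [Finset.univ_inter, hA, hI] at h ⊢
  linarith

theorem sum_univ_threeValued_sq {A I : Finset V} (hAI : Disjoint A I) (a r : ℝ) {d p : ℕ} {m : ℝ}
    (hA : A.card = d) (hI : I.card = p) (hV : (Fintype.card V : ℝ) = d + m + p) :
    ∑ v, threeValued A I a r 1 v ^ 2 = d * a ^ 2 + m + p * r ^ 2 := by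
  simp only [threeValued_sq, one_pow]
  exact sum_univ_threeValued hAI _ _ hA hI hV

variable {G : SimpleGraph V} {S : Finset V} {f : V → ι} {A I : Finset V} {d p : ℕ} {m a r y : ℝ}

/-- The test vector has the sum and norm of the Perron vector, so the complete-graph terms of the
Rayleigh bound and of `IsPerronTriple.rayleigh` cancel. Only the nonadjacent pairs remain to be
compared. -/
theorem sepForm_le_of_radius_le (hG : G.Connected)
    (hf : ∀ u v, u ∉ S → v ∉ S → G.Adj u v → f u = f v) (hAI : Disjoint A I)
    (hA : A.card = d) (hI : I.card = p) (hV : (Fintype.card V : ℝ) = d + m + p) (hm : 0 ≤ m)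
    (h : IsPerronTriple d m p a r y) (hη : distSignlessRadius G ≤ y) :
    sepForm S f (threeValued A I a r 1) ≤
      2 * p ^ 2 * r ^ 2 + p * m * (1 + r) ^ 2 - 2 * p * r ^ 2 := by
  have h1 := rayleigh_separated hG hf (threeValued A I a r 1)
  rw [sum_univ_threeValued hAI a r hA hI hV, sum_univ_threeValued_sq hAI a r hA hI hV, hV] at h1
  have h2 := h.rayleigh
  have h3 : distSignlessRadius G * (d * a ^ 2 + m + p * r ^ 2) ≤
      y * (d * a ^ 2 + m + p * r ^ 2) := mul_le_mul_of_nonneg_right hη (by positivity)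
  linarith

theorem sepForm_lt_of_radius_le (hG : G.Connected)
    (hf : ∀ u v, u ∉ S → v ∉ S → G.Adj u v → f u = f v) (hAI : Disjoint A I)
    (hA : A.card = d) (hI : I.card = p) (hV : (Fintype.card V : ℝ) = d + m + p) (hm : 0 ≤ m)
    (h : IsPerronTriple d m p a r y) (hη : distSignlessRadius G ≤ y) {u₀ v₀ : V} (hne : u₀ ≠ v₀)
    (hadj : ¬ G.Adj u₀ v₀) (hsep : u₀ ∈ S ∨ v₀ ∈ S ∨ f u₀ = f v₀) :
    sepForm S f (threeValued A I a r 1) <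
      2 * p ^ 2 * r ^ 2 + p * m * (1 + r) ^ 2 - 2 * p * r ^ 2 := by
  have hpos : ∀ v, 0 < threeValued A I a r 1 v := by
    intro v
    have h1 := h.a_pos
    have h2 := h.r_pos
    unfold threeValued
    split_ifs <;> linarith
  have h1 := rayleigh_separated_lt hG hf (threeValued A I a r 1) hne hadj hsep
    (add_pos (hpos _) (hpos _))
  rw [sum_univ_threeValued hAI a r hA hI hV, sum_univ_threeValued_sq hAI a r hA hI hV, hV] at h1
  have h2 := h.rayleigh
  have h3 : distSignlessRadius G * (d * a ^ 2 + m + p * r ^ 2) ≤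
      y * (d * a ^ 2 + m + p * r ^ 2) := mul_le_mul_of_nonneg_right hη (by positivity)
  linarith

/-- Evaluation of the test vector that is `r` on one vertex of each class in `J`. -/
theorem sepForm_representatives (hAS : A ⊆ S) {J : Finset ι} {ρ : ι → V}
    (hρ : ∀ i, ρ i ∉ S ∧ f (ρ i) = i) {μ : ι → ℝ}
    (hμ : ∀ i, ((sepClass S f i).card : ℝ) = (if i ∈ J then 1 else 0) + μ i) :
    sepForm S f (threeValued A (J.image ρ) a r 1) =
      2 * (J.card : ℝ) ^ 2 * r ^ 2 + J.card * (∑ i, μ i) * (1 + r) ^ 2 - 2 * J.card * r ^ 2 +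
        2 * (∑ i, μ i) ^ 2 - 2 * ∑ i, μ i ^ 2 - (1 + r) ^ 2 * ∑ i ∈ J, μ i := by
  have hAI : Disjoint A (J.image ρ) := by
    rw [Finset.disjoint_left]
    intro v hv hv'
    obtain ⟨i, -, rfl⟩ := Finset.mem_image.1 hv'
    exact (hρ i).1 (hAS hv)
  have hα : ∀ i, ((sepClass S f i ∩ A).card : ℝ) = 0 := by
    intro i
    rw [Nat.cast_eq_zero, Finset.card_eq_zero, ← Finset.disjoint_iff_inter_eq_empty,
      Finset.disjoint_left]
    intro v hv hv'
    exact (mem_sepClass.1 hv).1 (hAS hv')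
  have hc : ∀ i, ((sepClass S f i ∩ J.image ρ).card : ℝ) = if i ∈ J then 1 else 0 := by
    intro i
    have : sepClass S f i ∩ J.image ρ = if i ∈ J then {ρ i} else ∅ := by
      ext v
      simp only [Finset.mem_inter, mem_sepClass, Finset.mem_image]
      constructor
      · rintro ⟨⟨-, h1⟩, j, hj, rfl⟩
        have : j = i := (hρ j).2.symm.trans h1
        subst this
        simp [hj]
      · intro h
        split_ifs at h with hi
        · rw [Finset.mem_singleton] at h
          subst h
          exact ⟨hρ i, i, hi, rfl⟩
        · simp at h
    rw [this]
    split_ifs <;> simp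
  rw [sepForm_threeValued S f hAI a r hα hc (by simpa using hμ)]
  have e1 : ∑ i, (if i ∈ J then (1 : ℝ) else 0) = J.card := by simp
  have e2 : ∑ i, (if i ∈ J then (1 : ℝ) else 0) * μ i = ∑ i ∈ J, μ i := by
    simp [ite_mul, Finset.sum_ite_mem]
  have e3 : ∀ i, ((0 : ℝ) + (if i ∈ J then 1 else 0) + μ i) *
      (0 * a ^ 2 + (if i ∈ J then 1 else 0) * r ^ 2 + μ i) +
        (0 * a + (if i ∈ J then 1 else 0) * r + μ i) ^ 2 =
      2 * r ^ 2 * (if i ∈ J then 1 else 0) + (1 + r) ^ 2 * ((if i ∈ J then 1 else 0) * μ i) +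
        2 * μ i ^ 2 := by
    intro i
    split_ifs <;> ring
  simp only [e3, Finset.sum_add_distrib, ← Finset.mul_sum, e1, e2, Finset.sum_const_zero]
  ring

/-- Comparison when the separator is at least as large as in the extremal graph. -/
theorem gain_le_loss_of_large_separator (hG : G.Connected)
    (hf : ∀ u v, u ∉ S → v ∉ S → G.Adj u v → f u = f v) (hsurj : ∀ i, ∃ v, v ∉ S ∧ f v = i)
    (hdS : d ≤ S.card) (hpι : p + 1 ≤ Fintype.card ι)
    (hV : (Fintype.card V : ℝ) = d + m + p) (hm : 0 ≤ m)
    (h : IsPerronTriple d m p a r y) (hη : distSignlessRadius G ≤ y) :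
    ∃ (q : ι) (N B R : ℝ), 0 ≤ R ∧ N = m - (S.card - d) ∧
      R + (Fintype.card ι - 1 - p : ℝ) ≤ B ∧
      2 * (N * B) ≤ (1 + r) ^ 2 * (p * (S.card - d) + R) ∧
      4 * (B * (N - B)) ≤ (1 + r) ^ 2 * (p * (S.card - d) + R) ∧
      (B = 0 → S.card = d → Fintype.card ι = p + 1 → (∀ i, i ≠ q → (sepClass S f i).card = 1) ∧
        ∀ u v, u ≠ v → (u ∈ S ∨ v ∈ S ∨ f u = f v) → G.Adj u v) := by
  have hι : Nonempty ι := Fintype.card_pos_iff.1 (by omega)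
  obtain ⟨q, -, hq⟩ := Finset.exists_max_image Finset.univ (fun i => (sepClass S f i).card)
    Finset.univ_nonempty
  choose ρ hρ using hsurj
  obtain ⟨J, hJ, hJp⟩ : ∃ J ⊆ Finset.univ.erase q, J.card = p :=
    Finset.exists_subset_card_eq (by
      rw [Finset.card_erase_of_mem (Finset.mem_univ q), Finset.card_univ]
      omega)
  obtain ⟨A, hAS, hA⟩ := Finset.exists_subset_card_eq hdS
  have hqJ : q ∉ J := fun hqJ => by simpa using hJ hqJ
  have hpos : ∀ i, 1 ≤ (sepClass S f i).card := fun i =>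
    Finset.card_pos.2 ⟨ρ i, mem_sepClass.2 (hρ i)⟩
  -- The number of vertices of value `1` in each class. As `q` is a largest class outside `J`, it
  -- also maximises `μ`.
  set μ : ι → ℝ := fun i => (sepClass S f i).card - if i ∈ J then 1 else 0 with hμ
  have hμ' : ∀ i, ((sepClass S f i).card : ℝ) = (if i ∈ J then 1 else 0) + μ i := fun i => by
    simp [hμ]
  have hμ0 : ∀ i, 0 ≤ μ i := by
    intro i
    have : (1 : ℝ) ≤ (sepClass S f i).card := by exact_mod_cast hpos i
    simp only [hμ]
    split_ifs <;> linarith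
  have hμq : ∀ i, μ i ≤ μ q := by
    intro i
    have : ((sepClass S f i).card : ℝ) ≤ (sepClass S f q).card := by
      exact_mod_cast hq i (Finset.mem_univ i)
    simp only [hμ, hqJ, if_false]
    split_ifs <;> linarith
  have hIcard : (J.image ρ).card = p := by
    rw [Finset.card_image_of_injective, hJp]
    intro i j hij
    rw [← (hρ i).2, hij, (hρ j).2]
  have hAI : Disjoint A (J.image ρ) := by
    rw [Finset.disjoint_left]
    intro v hv hv'
    obtain ⟨i, -, rfl⟩ := Finset.mem_image.1 hv'
    exact (hρ i).1 (hAS hv)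
  have hN : ∑ i, μ i = m - (S.card - d) := by
    have h1 : ∑ i, ((sepClass S f i).card : ℝ) = (Sᶜ.card : ℝ) := by
      exact_mod_cast sum_card_sepClass S f
    have h2 : (S.card : ℝ) + Sᶜ.card = Fintype.card V := by
      exact_mod_cast Finset.card_add_card_compl S
    simp only [hμ', Finset.sum_add_distrib] at h1
    rw [Finset.sum_ite_mem, Finset.univ_inter, Finset.sum_const, hJp, nsmul_eq_mul, mul_one] at h1
    linarith
  have hB : ∑ i, μ i = μ q + ∑ i ∈ Finset.univ.erase q, μ i :=
    (Finset.add_sum_erase _ _ (Finset.mem_univ q)).symm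
  have hB2 : ∑ i, μ i ^ 2 = μ q ^ 2 + ∑ i ∈ Finset.univ.erase q, μ i ^ 2 :=
    (Finset.add_sum_erase _ _ (Finset.mem_univ q)).symm
  have hform := sepForm_representatives (a := a) (r := r) hAS (J := J) hρ hμ'
  rw [hJp] at hform
  have hle := sepForm_le_of_radius_le hG hf hAI hA hIcard hV hm h hη
  rw [hform, hN] at hle
  set N := m - ((S.card : ℝ) - d) with hNdef
  set B := ∑ i ∈ Finset.univ.erase q, μ i with hBdef
  have hB0 : 0 ≤ B := Finset.sum_nonneg fun i _ => hμ0 i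
  -- Left, the gain from pairs of value `1` in different classes. Right, the losses: the `|S| - d`
  -- vertices of value `1` inside `S`, and the pairs of a representative with the rest of its own
  -- class.
  have hmain : 2 * N ^ 2 - 2 * ∑ i, μ i ^ 2 ≤ (1 + r) ^ 2 * (p * (S.card - d) + ∑ i ∈ J, μ i) := by
    have : m = N + (S.card - d) := by rw [hNdef]; ring
    rw [this] at hle
    linarith
  refine ⟨q, N, B, ∑ i ∈ J, μ i, Finset.sum_nonneg fun i _ => hμ0 i, rfl, ?_, ?_, ?_, ?_⟩
  · rw [hBdef, ← Finset.sum_sdiff hJ, add_comm]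
    refine add_le_add ?_ le_rfl
    have hcard : ((Finset.univ.erase q \ J).card : ℝ) = Fintype.card ι - 1 - p := by
      rw [Finset.card_sdiff_of_subset hJ, hJp, Finset.card_erase_of_mem (Finset.mem_univ q),
        Finset.card_univ, Nat.cast_sub (by omega), Nat.cast_sub (by omega)]
      simp
    rw [← hcard, ← nsmul_one, ← Finset.sum_const]
    refine Finset.sum_le_sum fun i hi => ?_
    have : (1 : ℝ) ≤ (sepClass S f i).card := by exact_mod_cast hpos i
    simp only [hμ, (Finset.mem_sdiff.1 hi).2, if_false]
    linarith
  -- Two lower bounds for the gain: `∑ μ² ≤ (N-B)N` gives `2NB`, and below `∑ μ² ≤ (N-B)² + B²`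
  -- gives `4B(N-B)`.
  · have h1 : ∑ i, μ i ^ 2 ≤ μ q * ∑ i, μ i := by
      simp only [sq]
      exact sum_mul_le_mul_sum_of_le (fun i _ => hμq i) fun i _ => hμ0 i
    rw [hN] at h1 hB
    have : μ q = N - B := by linarith
    rw [this] at h1
    nlinarith
  · have h1 : ∑ i ∈ Finset.univ.erase q, μ i ^ 2 ≤ B * B := by
      simp only [sq]
      exact sum_mul_le_mul_sum_of_le
        (fun i hi => Finset.single_le_sum (fun j _ => hμ0 j) hi) fun i _ => hμ0 i
    rw [hN] at hB
    have : μ q = N - B := by linarith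
    rw [this] at hB2
    nlinarith
  · intro hB0' hSd hιp
    have hJe : J = Finset.univ.erase q :=
      Finset.eq_of_subset_of_card_le hJ (by
        rw [Finset.card_erase_of_mem (Finset.mem_univ q), Finset.card_univ]
        omega)
    have hzero : ∀ i ∈ Finset.univ.erase q, μ i = 0 := by
      rw [hBdef] at hB0'
      exact (Finset.sum_eq_zero_iff_of_nonneg fun i _ => hμ0 i).1 hB0'
    refine ⟨fun i hi => ?_, ?_⟩
    · have hi' : i ∈ Finset.univ.erase q := by simp [hi]
      have h1 := hμ' i
      rw [hzero i hi', hJe, if_pos hi', add_zero] at h1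
      exact_mod_cast h1
    · by_contra hno
      push Not at hno
      obtain ⟨u, v, huv, hsep, hadj⟩ := hno
      have hlt := sepForm_lt_of_radius_le hG hf hAI hA hIcard hV hm h hη huv hadj hsep
      rw [hform, hN, hB2, Finset.sum_eq_zero (s := Finset.univ.erase q)
        (fun i hi => by rw [hzero i hi]; simp), hJe, ← hBdef, hB0'] at hlt
      have h1 : μ q = N := by rw [hN, hB0'] at hB; linarith
      have h2 : N = m := by rw [hNdef, hSd]; ring
      rw [h1, h2] at hlt
      linarith

end Comparison

/-! ### Small separators, the two-valued vector, and recognition of the extremal graph. -/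

section Comparison

variable {V ι : Type*} [Fintype V] [DecidableEq V] [Fintype ι] [DecidableEq ι]
  {G : SimpleGraph V} {S : Finset V} {f : V → ι} {d p : ℕ} {m a r y : ℝ}

/-- Comparison when the separator has `t` vertices fewer than in the extremal graph. -/
theorem gain_le_loss_of_small_separator (hG : G.Connected)
    (hf : ∀ u v, u ∉ S → v ∉ S → G.Adj u v → f u = f v) [Nonempty ι] {t κ : ℕ}
    (hSt : S.card + t = d) (hcl : ∀ i, t + 1 ≤ (sepClass S f i).card) (hκt : κ ≤ t)
    (hκp : p ≤ (Fintype.card ι - 1) * (κ + 1))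
    (hV : (Fintype.card V : ℝ) = d + m + p) (hm : 0 ≤ m)
    (h : IsPerronTriple d m p a r y) (hη : distSignlessRadius G ≤ y) (ha : 1 / 2 ≤ a) :
    ∃ R : ℝ, (Fintype.card ι - 1 : ℝ) * (t + 1) - p ≤ R ∧
      p * t * (r + a) ^ 2 + 2 * m * R - 2 * r ^ 2 * κ * p - (1 + r) ^ 2 * (κ + 1) * R ≤ 0 := by
  obtain ⟨q, -, hq⟩ := Finset.exists_max_image Finset.univ (fun i => (sepClass S f i).card)
    Finset.univ_nonempty
  -- Reserving `κ + 1` vertices per class caps the number of `r`-values in any class; a smaller `κ`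
  -- spreads them more evenly and loses fewer pairs.
  choose J hJ hJκ using fun i =>
    Finset.exists_subset_card_eq (show κ + 1 ≤ (sepClass S f i).card by have := hcl i; omega)
  obtain ⟨T, hT, hTt⟩ :=
    Finset.exists_subset_card_eq (show t ≤ (sepClass S f q).card by have := hcl q; omega)
  have hU : ((Finset.univ.erase q).biUnion J).card = (Fintype.card ι - 1) * (κ + 1) := by
    rw [Finset.card_biUnion, Finset.sum_congr rfl fun i _ => hJκ i, Finset.sum_const,
      Finset.card_erase_of_mem (Finset.mem_univ q), Finset.card_univ, smul_eq_mul]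
    intro i _ j _ hij
    rw [Function.onFun, Finset.disjoint_left]
    intro v hv hv'
    exact hij ((mem_sepClass.1 (hJ i hv)).2.symm.trans (mem_sepClass.1 (hJ j hv')).2)
  obtain ⟨I, hIU, hI⟩ := Finset.exists_subset_card_eq (hκp.trans hU.ge)
  have hIJ : ∀ v ∈ I, v ∉ S ∧ f v ≠ q ∧ v ∈ J (f v) := by
    intro v hv
    obtain ⟨i, hi, hvi⟩ := Finset.mem_biUnion.1 (hIU hv)
    obtain ⟨h1, rfl⟩ := mem_sepClass.1 (hJ i hvi)
    exact ⟨h1, by simpa using hi, hvi⟩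
  have hAI : Disjoint (S ∪ T) I := by
    rw [Finset.disjoint_left]
    intro v hv hvI
    obtain ⟨h1, h2, -⟩ := hIJ v hvI
    rcases Finset.mem_union.1 hv with hv | hv
    · exact h1 hv
    · exact h2 (mem_sepClass.1 (hT hv)).2
  have hA : (S ∪ T).card = d := by
    rw [Finset.card_union_of_disjoint, hTt, hSt]
    rw [Finset.disjoint_right]
    exact fun v hv => (mem_sepClass.1 (hT hv)).1
  set α : ι → ℝ := fun i => if i = q then t else 0 with hα
  set c : ι → ℝ := fun i => (sepClass S f i ∩ I).card with hc
  set μ : ι → ℝ := fun i => (sepClass S f i).card - α i - c i with hμ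
  have hα' : ∀ i, ((sepClass S f i ∩ (S ∪ T)).card : ℝ) = α i := by
    intro i
    have : sepClass S f i ∩ (S ∪ T) = if i = q then T else ∅ := by
      ext v
      have hvT : v ∈ T → v ∉ S ∧ f v = q := fun hv => mem_sepClass.1 (hT hv)
      simp only [Finset.mem_inter, Finset.mem_union, mem_sepClass]
      split_ifs with hi
      · subst hi
        tauto
      · simp only [Finset.notMem_empty, iff_false]
        rintro ⟨⟨h1, h2⟩, h3 | h3⟩
        · exact h1 h3
        · exact hi (h2.symm.trans (hvT h3).2)
    rw [this, hα]
    split_ifs <;> simp [*]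
  have hcκ : ∀ i, c i ≤ κ + 1 := by
    intro i
    have : (sepClass S f i ∩ I).card ≤ κ + 1 := by
      rw [← hJκ i]
      refine Finset.card_le_card fun v hv => ?_
      obtain ⟨hv1, hv2⟩ := Finset.mem_inter.1 hv
      have := (hIJ v hv2).2.2
      rwa [(mem_sepClass.1 hv1).2] at this
    have h1 : ((sepClass S f i ∩ I).card : ℝ) ≤ ((κ + 1 : ℕ) : ℝ) := Nat.cast_le.2 this
    rwa [Nat.cast_add, Nat.cast_one] at h1
  have hc0 : ∀ i, 0 ≤ c i := fun i => Nat.cast_nonneg _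
  have hcq : c q = 0 := by
    simp only [hc, Nat.cast_eq_zero, Finset.card_eq_zero]
    rw [← Finset.disjoint_iff_inter_eq_empty, Finset.disjoint_left]
    exact fun v hv hvI => (hIJ v hvI).2.1 (mem_sepClass.1 hv).2
  have hclR : ∀ i, (t : ℝ) + 1 ≤ (sepClass S f i).card := fun i => by exact_mod_cast hcl i
  have hqR : ∀ i, ((sepClass S f i).card : ℝ) ≤ (sepClass S f q).card := fun i => by
    exact_mod_cast hq i (Finset.mem_univ i)
  have hκtR : (κ : ℝ) ≤ t := by exact_mod_cast hκt
  have hαq : α q = t := if_pos rfl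
  have hα0 : ∀ i ∈ Finset.univ.erase q, α i = 0 := fun i hi => if_neg (Finset.ne_of_mem_erase hi)
  have hμ0 : ∀ i ∈ Finset.univ.erase q, 0 ≤ μ i := by
    intro i hi
    simp only [hμ, hα0 i hi]
    linarith [hclR i, hcκ i]
  have hμn : ∀ i ∈ Finset.univ.erase q, μ i ≤ (sepClass S f q).card := by
    intro i hi
    simp only [hμ, hα0 i hi]
    linarith [hqR i, hc0 i]
  have hμq : μ q = (sepClass S f q).card - t := by simp only [hμ, hαq, hcq, sub_zero]
  have hsplit : ∀ g : ι → ℝ, ∑ i, g i = g q + ∑ i ∈ Finset.univ.erase q, g i := fun g =>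
    (Finset.add_sum_erase _ _ (Finset.mem_univ q)).symm
  have hsα : ∑ i, α i = t := by simp [hα]
  have hsc : ∑ i, c i = p := by
    have : Disjoint S I := Finset.disjoint_of_subset_left Finset.subset_union_left hAI
    simp only [hc, ← hI]
    exact_mod_cast sum_card_sepClass_inter S f I this
  have hscard : ∑ i, ((sepClass S f i).card : ℝ) = m + p + t := by
    have h1 : ∑ i, ((sepClass S f i).card : ℝ) = (Sᶜ.card : ℝ) := by
      exact_mod_cast sum_card_sepClass S f
    have h2 : (S.card : ℝ) + Sᶜ.card = Fintype.card V := by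
      exact_mod_cast Finset.card_add_card_compl S
    have h3 : (S.card : ℝ) + t = d := by exact_mod_cast hSt
    linarith
  have hsμ : ∑ i, μ i = m := by
    simp only [hμ, Finset.sum_sub_distrib, hsα, hsc, hscard]
    ring
  set R := ∑ i ∈ Finset.univ.erase q, μ i with hR
  have hR0 : 0 ≤ R := Finset.sum_nonneg hμ0
  have hn : ((sepClass S f q).card : ℝ) = m + t - R := by
    have := hsplit μ
    rw [hsμ, hμq, ← hR] at this
    linarith
  refine ⟨R, ?_, ?_⟩
  · have h1 : ∑ i ∈ Finset.univ.erase q, c i = p := by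
      have := hsplit c
      rw [hsc, hcq] at this
      linarith
    have h2 : R = ∑ i ∈ Finset.univ.erase q, ((sepClass S f i).card : ℝ) - p := by
      rw [hR, ← h1, ← Finset.sum_sub_distrib]
      refine Finset.sum_congr rfl fun i hi => ?_
      simp only [hμ, hα0 i hi, sub_zero]
    have h3 : (Fintype.card ι - 1 : ℝ) * (t + 1) ≤
        ∑ i ∈ Finset.univ.erase q, ((sepClass S f i).card : ℝ) := by
      have h4 := Finset.sum_le_sum (s := Finset.univ.erase q) fun i _ => hclR i
      rw [Finset.sum_const, Finset.card_erase_of_mem (Finset.mem_univ q), Finset.card_univ,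
        nsmul_eq_mul, Nat.cast_sub Fintype.card_pos, Nat.cast_one] at h4
      exact h4
    linarith
  · have hle := sepForm_le_of_radius_le hG hf hAI hA hI hV hm h hη
    rw [sepForm_threeValued S f hAI a r (α := α) (c := c) (μ := μ) hα' (fun i => rfl)
      (fun i => by simp only [hμ]; ring), hsα, hsc, hsμ, hsplit, hαq, hcq, hμq, hn] at hle
    have hterm : ∑ i ∈ Finset.univ.erase q, ((α i + c i + μ i) *
        (α i * a ^ 2 + c i * r ^ 2 + μ i) + (α i * a + c i * r + μ i) ^ 2) ≤
        2 * r ^ 2 * ((κ + 1) * p) + (1 + r) ^ 2 * ((κ + 1) * R) + 2 * ((m + t - R) * R) := by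
      have h1 : ∑ i ∈ Finset.univ.erase q, c i * c i ≤ (κ + 1) * p := by
        have := sum_mul_le_mul_sum_of_le (s := Finset.univ.erase q) (fun i _ => hcκ i)
          fun i _ => hc0 i
        have h2 := hsplit c
        rw [hsc, hcq, zero_add] at h2
        rwa [← h2] at this
      have h2 : ∑ i ∈ Finset.univ.erase q, c i * μ i ≤ (κ + 1) * R :=
        sum_mul_le_mul_sum_of_le (fun i _ => hcκ i) hμ0
      have h3 : ∑ i ∈ Finset.univ.erase q, μ i * μ i ≤ (m + t - R) * R := by
        rw [← hn]
        exact sum_mul_le_mul_sum_of_le hμn hμ0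
      have h4 : ∑ i ∈ Finset.univ.erase q, ((α i + c i + μ i) *
          (α i * a ^ 2 + c i * r ^ 2 + μ i) + (α i * a + c i * r + μ i) ^ 2) =
          2 * r ^ 2 * ∑ i ∈ Finset.univ.erase q, c i * c i +
            (1 + r) ^ 2 * ∑ i ∈ Finset.univ.erase q, c i * μ i +
            2 * ∑ i ∈ Finset.univ.erase q, μ i * μ i := by
        simp only [Finset.mul_sum, ← Finset.sum_add_distrib]
        refine Finset.sum_congr rfl fun i hi => ?_
        rw [hα0 i hi]
        ring
      rw [h4]
      have h5 : (0 : ℝ) ≤ 2 * r ^ 2 := by positivity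
      have h6 : (0 : ℝ) ≤ (1 + r) ^ 2 := by positivity
      have h7 := mul_le_mul_of_nonneg_left h1 h5
      have h8 := mul_le_mul_of_nonneg_left h2 h6
      linarith
    -- The pairs between the `t` vertices of value `a` in class `q` and the `R` vertices of value
    -- `1` elsewhere outweigh the `2tR` lost in `hterm`, because `(3/2)² > 2`.
    have hextra : 0 ≤ t * R * ((1 + a) ^ 2 - 2) :=
      mul_nonneg (mul_nonneg (Nat.cast_nonneg t) hR0) (by nlinarith)
    clear_value R
    linear_combination hle + hterm + hextra

/-- Rayleigh bound for the vector that is `1` on the separator and `2` elsewhere. -/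
theorem rayleigh_separator_one_two (hG : G.Connected)
    (hf : ∀ u v, u ∉ S → v ∉ S → G.Adj u v → f u = f v) (hsurj : ∀ i, ∃ v, v ∉ S ∧ f v = i)
    {s L Q n : ℝ} (hs : (S.card : ℝ) = s) (hL : (Sᶜ.card : ℝ) = L) (hn : (Fintype.card V : ℝ) = n)
    (hQ : (Fintype.card ι : ℝ) = Q) :
    (n - 2) * (s + 4 * L) + (s + 2 * L) ^ 2 + 8 * ((Q - 1) * (2 * L - Q)) ≤
      distSignlessRadius G * (s + 4 * L) := by
  have hd : Disjoint S (∅ : Finset V) := Finset.disjoint_empty_right S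
  have h := rayleigh_separated hG hf (threeValued S ∅ 1 1 2)
  have hc : ∀ i, ∑ v ∈ sepClass S f i, threeValued S ∅ 1 1 2 v = (sepClass S f i).card * 2 ∧
      ∑ v ∈ sepClass S f i, threeValued S ∅ 1 1 2 v ^ 2 = (sepClass S f i).card * 4 := by
    intro i
    have h1 : sepClass S f i ∩ S = ∅ := by
      rw [← Finset.disjoint_iff_inter_eq_empty, Finset.disjoint_left]
      exact fun v hv => (mem_sepClass.1 hv).1
    have h2 : sepClass S f i \ (S ∪ ∅) = sepClass S f i := by
      rw [Finset.union_empty, Finset.sdiff_eq_self_iff_disjoint,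
        Finset.disjoint_iff_inter_eq_empty, h1]
    simp only [threeValued_sq]
    rw [sum_threeValued hd, sum_threeValued hd, h1, h2]
    norm_num
  have hO : ∑ v ∈ Sᶜ, threeValued S ∅ 1 1 2 v = L * 2 ∧
      ∑ v ∈ Sᶜ, threeValued S ∅ 1 1 2 v ^ 2 = L * 4 := by
    simp only [threeValued_sq]
    rw [sum_threeValued hd, sum_threeValued hd]
    have h1 : Sᶜ \ (S ∪ ∅) = Sᶜ := by
      rw [Finset.union_empty, Finset.sdiff_eq_self_iff_disjoint]
      exact disjoint_compl_left
    have h2 : Sᶜ ∩ S = ∅ := by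
      rw [← Finset.disjoint_iff_inter_eq_empty]
      exact disjoint_compl_left
    rw [h1, h2, hL]
    norm_num
  have hU : ∑ v, threeValued S ∅ 1 1 2 v = s + L * 2 ∧
      ∑ v, threeValued S ∅ 1 1 2 v ^ 2 = s + L * 4 := by
    simp only [threeValued_sq]
    rw [sum_threeValued hd, sum_threeValued hd]
    have h1 : Finset.univ \ (S ∪ ∅) = Sᶜ := by
      rw [Finset.union_empty, Finset.compl_eq_univ_sdiff]
    rw [h1, hL, Finset.univ_inter, hs]
    norm_num
  have hform : sepForm S f (threeValued S ∅ 1 1 2) =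
      8 * (L ^ 2 - ∑ i, ((sepClass S f i).card : ℝ) ^ 2) := by
    rw [sepForm]
    change _ - ∑ i, (((sepClass S f i).card : ℝ) *
      ∑ v ∈ sepClass S f i, threeValued S ∅ 1 1 2 v ^ 2 +
        (∑ v ∈ sepClass S f i, threeValued S ∅ 1 1 2 v) ^ 2) = _
    simp only [hO, hc, hL]
    have : ∀ i, ((sepClass S f i).card : ℝ) * ((sepClass S f i).card * 4) +
        ((sepClass S f i).card * 2) ^ 2 = 8 * (sepClass S f i).card ^ 2 := fun i => by ring
    simp only [this, ← Finset.mul_sum]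
    ring
  rw [hform, hU.1, hU.2, hn] at h
  have hsum : ∑ i, ((sepClass S f i).card : ℝ) = L := by
    rw [← hL]
    exact_mod_cast sum_card_sepClass S f
  have hpos : ∀ i, (0 : ℝ) ≤ (sepClass S f i).card - 1 := by
    intro i
    obtain ⟨v, hv⟩ := hsurj i
    have : 1 ≤ (sepClass S f i).card := Finset.card_pos.2 ⟨v, mem_sepClass.2 hv⟩
    have : (1 : ℝ) ≤ (sepClass S f i).card := by exact_mod_cast this
    linarith
  have hs1 : ∑ i, (((sepClass S f i).card : ℝ) - 1) = L - Q := by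
    rw [Finset.sum_sub_distrib, hsum, Finset.sum_const, Finset.card_univ, nsmul_eq_mul, mul_one, hQ]
  -- The worst case is one large class and singletons; it turns `L² - ∑ |C|²` into `(Q-1)(2L-Q)`.
  have hsq : ∑ i, (((sepClass S f i).card : ℝ) - 1) ^ 2 ≤ (L - Q) ^ 2 := by
    rw [← hs1]
    exact Finset.sum_sq_le_sq_sum_of_nonneg fun i _ => hpos i
  have hsq' : ∑ i, (((sepClass S f i).card : ℝ) - 1) ^ 2 =
      ∑ i, ((sepClass S f i).card : ℝ) ^ 2 - 2 * L + Q := by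
    rw [← hsum, Finset.mul_sum, ← Finset.sum_sub_distrib, ← hQ, ← Finset.card_univ,
      ← nsmul_one, ← Finset.sum_const, ← Finset.sum_add_distrib]
    exact Finset.sum_congr rfl fun i _ => by ring
  nlinarith

/-- A graph in which `S` is joined to everything and all classes outside `S` are cliques, all but one
of them single vertices, is `K_d ∨ (K_m ∪ p K₁)`. -/
theorem nonempty_iso_joinCliqueIndep {m : ℕ}
    (hf : ∀ u v, u ∉ S → v ∉ S → G.Adj u v → f u = f v) (hS : S.card = d)
    (hι : Fintype.card ι = p + 1) (hV : Fintype.card V = d + m + p) (q : ι)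
    (hcl : ∀ i, i ≠ q → (sepClass S f i).card = 1)
    (hadj : ∀ u v, u ≠ v → (u ∈ S ∨ v ∈ S ∨ f u = f v) → G.Adj u v) :
    Nonempty (G ≃g joinCliqueIndep d m p) := by
  set I : Finset V := Sᶜ.filter fun v => f v ≠ q with hI
  have hmemI : ∀ v, v ∈ I ↔ v ∉ S ∧ f v ≠ q := fun v => by simp [hI]
  have hinj : ∀ u ∈ I, ∀ v ∈ I, f u = f v → u = v := by
    intro u hu v hv huv
    rw [hmemI] at hu hv
    exact Finset.card_le_one.1 (hcl _ hv.2).le u (mem_sepClass.2 ⟨hu.1, huv⟩) v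
      (mem_sepClass.2 ⟨hv.1, rfl⟩)
  have hsum : ∑ i ∈ Finset.univ.erase q, (sepClass S f i).card = p := by
    rw [Finset.sum_congr rfl fun i hi => hcl i (Finset.ne_of_mem_erase hi), Finset.sum_const,
      Finset.card_erase_of_mem (Finset.mem_univ q), Finset.card_univ, hι]
    simp
  have htot : (sepClass S f q).card + p = m + p := by
    have h1 := sum_card_sepClass S f
    rw [← Finset.add_sum_erase _ _ (Finset.mem_univ q), hsum, Finset.card_compl, hV, hS] at h1
    omega
  have hIp : I.card = p := by
    have h1 := Finset.card_filter_add_card_filter_not (s := Sᶜ) (fun v => f v = q)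
    have h2 : (Sᶜ.filter fun v => f v = q).card = (sepClass S f q).card := rfl
    rw [h2, Finset.card_compl, hV, hS] at h1
    have h3 : I.card = (Sᶜ.filter fun v => ¬ f v = q).card := rfl
    omega
  have e1 := (Finset.equivFinOfCardEq hS).symm
  have e2 := (Finset.equivFinOfCardEq (show (sepClass S f q).card = m by omega)).symm
  have e3 := (Finset.equivFinOfCardEq hIp).symm
  have he2 : ∀ i, (e2 i : V) ∉ S ∧ f (e2 i) = q := fun i => mem_sepClass.1 (e2 i).2
  have he3 : ∀ i, (e3 i : V) ∉ S ∧ f (e3 i) ≠ q := fun i => (hmemI _).1 (e3 i).2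
  let g : Fin d ⊕ (Fin m ⊕ Fin p) → V :=
    Sum.elim (fun i => (e1 i : V)) (Sum.elim (fun i => (e2 i : V)) fun i => (e3 i : V))
  have hg : Function.Injective g := by
    refine Function.Injective.sumElim (Subtype.val_injective.comp e1.injective)
      (Function.Injective.sumElim (Subtype.val_injective.comp e2.injective)
        (Subtype.val_injective.comp e3.injective) fun i j hij => ?_) ?_
    · exact (he3 j).2 (hij ▸ (he2 i).2)
    · rintro i (j | j) hij
      · exact (he2 j).1 (by rw [Sum.elim_inl] at hij; exact hij ▸ (e1 i).2)
      · exact (he3 j).1 (by rw [Sum.elim_inr] at hij; exact hij ▸ (e1 i).2)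
  have hbij : Function.Bijective g := by
    rw [Fintype.bijective_iff_injective_and_card]
    refine ⟨hg, ?_⟩
    simp only [Fintype.card_sum, Fintype.card_fin, hV]
    omega
  refine ⟨(RelIso.mk (Equiv.ofBijective g hbij) ?_ : joinCliqueIndep d m p ≃g G).symm⟩
  intro x y
  change G.Adj (g x) (g y) ↔ _
  rcases x with i | x
  · rw [joinCliqueIndep_adj_inl]
    exact ⟨fun h e => h.ne (by rw [e]), fun h => hadj _ _ (hg.ne h.symm) (Or.inl (e1 i).2)⟩
  rcases y with j | y
  · rw [SimpleGraph.adj_comm (joinCliqueIndep d m p), joinCliqueIndep_adj_inl]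
    exact ⟨fun h e => h.ne (by rw [e]), fun h => hadj _ _ (hg.ne h) (Or.inr (Or.inl (e1 j).2))⟩
  rw [joinCliqueIndep_adj_inr]
  constructor
  · intro h
    rcases x with i | i <;> rcases y with j | j
    · exact ⟨i, j, rfl, rfl, fun e => h.ne (by rw [e])⟩
    · exact absurd ((hf _ _ (he2 i).1 (he3 j).1 h).symm.trans (he2 i).2) (he3 j).2
    · exact absurd ((hf _ _ (he3 i).1 (he2 j).1 h).trans (he2 j).2) (he3 i).2
    · exact absurd (hinj _ (e3 i).2 _ (e3 j).2 (hf _ _ (he3 i).1 (he3 j).1 h)) h.ne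
  · rintro ⟨i, j, rfl, rfl, hij⟩
    exact hadj _ _ (hg.ne (by simpa using hij)) (Or.inr (Or.inr ((he2 i).2.trans (he2 j).2.symm)))

end Comparison

/-! ### The cases by size of the separator, and the conclusion. -/

theorem card_le_card_compl_of_surjOn {V ι : Type*} [Fintype V] [DecidableEq V] [Fintype ι]
    {S : Finset V} {f : V → ι} (hsurj : ∀ i, ∃ v, v ∉ S ∧ f v = i) :
    Fintype.card ι ≤ Sᶜ.card := by
  choose ρ hρ using hsurj
  rw [← Finset.card_univ]
  refine Finset.card_le_card_of_injOn ρ (fun i _ => by simpa using (hρ i).1) ?_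
  intro i _ j _ hij
  rw [← (hρ i).2, hij, (hρ j).2]

/-- A class is closed under taking neighbours outside `S`, so it has at least
`minDegree + 1 - |S|` vertices. -/
theorem minDegree_lt_card_add_card_sepClass {V ι : Type*} [Fintype V] [DecidableEq V]
    [DecidableEq ι] {G : SimpleGraph V} [DecidableRel G.Adj] {S : Finset V} {f : V → ι}
    (hf : ∀ u v, u ∉ S → v ∉ S → G.Adj u v → f u = f v) {i : ι} (hi : ∃ v, v ∉ S ∧ f v = i) :
    G.minDegree < S.card + (sepClass S f i).card := by
  obtain ⟨v, hv, rfl⟩ := hi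
  have h1 : insert v (G.neighborFinset v) ⊆ S ∪ sepClass S f (f v) := by
    intro w hw
    rw [Finset.mem_union, mem_sepClass]
    rcases Finset.mem_insert.1 hw with rfl | hw
    · exact Or.inr ⟨hv, rfl⟩
    · rw [SimpleGraph.mem_neighborFinset] at hw
      by_cases hwS : w ∈ S
      · exact Or.inl hwS
      · exact Or.inr ⟨hwS, (hf v w hv hwS hw).symm⟩
  have h2 := (Finset.card_le_card h1).trans (Finset.card_union_le _ _)
  rw [Finset.card_insert_of_notMem (by simp), SimpleGraph.card_neighborFinset_eq_degree] at h2
  have := G.minDegree_le_degree v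
  omega

section Main

variable {V ι : Type*} [Fintype V] [DecidableEq V] [Fintype ι] [DecidableEq ι]
  {G : SimpleGraph V} {S : Finset V} {f : V → ι} {b k d p m : ℕ} {a r y : ℝ}

/-- A separator at least as large as that of the extremal graph forces the extremal graph; `b ≥ 3`. -/
theorem iso_of_large_separator_of_three_le (hG : G.Connected)
    (hf : ∀ u v, u ∉ S → v ∉ S → G.Adj u v → f u = f v) (hsurj : ∀ i, ∃ v, v ∉ S ∧ f v = i)
    (hb : 3 ≤ b) (hkd : k < d) (hdS : d ≤ S.card) (hι : Fintype.card ι = b * (S.card - k) + 2)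
    (hp : p = b * (d - k) + 1) (hV : Fintype.card V = d + m + p) (hpm : 5 * p ≤ m)
    (h : IsPerronTriple d m p a r y) (hη : distSignlessRadius G ≤ y) :
    Nonempty (G ≃g joinCliqueIndep d m p) := by
  obtain ⟨t, ht⟩ := Nat.exists_eq_add_of_le hdS
  obtain ⟨e, rfl⟩ := Nat.exists_eq_add_of_lt hkd
  have hp4 : 4 ≤ p := by
    rw [hp]
    have : k + e + 1 - k = e + 1 := by omega
    rw [this]
    nlinarith
  have hι' : Fintype.card ι = p + b * t + 1 := by
    rw [hι, hp, ht]
    have e1 : k + e + 1 + t - k = e + 1 + t := by omega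
    have e2 : k + e + 1 - k = e + 1 := by omega
    rw [e1, e2]
    ring
  have hVR : (Fintype.card V : ℝ) = (k + e + 1 : ℕ) + m + p := by exact_mod_cast hV
  have hd0 : (0 : ℝ) < (k + e + 1 : ℕ) := by positivity
  have hp0 : (4 : ℝ) ≤ p := by exact_mod_cast hp4
  have hm1 : 1 ≤ m := by omega
  have hm1R : (1 : ℝ) ≤ m := by exact_mod_cast hm1
  have hpmR : 5 * (p : ℝ) ≤ m := by exact_mod_cast hpm
  have hq := h.quadratic_le hd0 (by linarith) hm1R
  have hW := mul_one_add_sq_le (by linarith) h.r_pos hq hpmR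
  obtain ⟨q, N, B, R, hR, hN, hB, h1, -, h3⟩ := gain_le_loss_of_large_separator hG hf hsurj hdS
    (by rw [hι']; omega) hVR (by positivity) h hη
  have hst : (S.card : ℝ) - (k + e + 1 : ℕ) = t := by rw [ht]; push_cast; ring
  rw [hst] at hN h1
  rw [hι'] at hB
  push_cast at hB
  have htm : (b + 1) * t ≤ m := by
    have h4 := card_le_card_compl_of_surjOn hsurj
    rw [Finset.card_compl, hι', hV, ht] at h4
    have : (b + 1) * t = b * t + t := by ring
    omega
  obtain ⟨hB0, ht0⟩ := gain_le_loss_of_three_le (W := (1 + r) ^ 2) (b := b) (by linarith)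
    (by exact_mod_cast hb) hp0 hW (Nat.cast_nonneg t) hR hN (by exact_mod_cast htm)
    (by linarith) h1
  have ht0' : t = 0 := by exact_mod_cast ht0
  subst ht0'
  have hcl := h3 hB0 (by omega) (by simpa using hι')
  exact nonempty_iso_joinCliqueIndep hf (by omega) (by simpa using hι') hV q hcl.1 hcl.2

/-- The analogue of `iso_of_large_separator_of_three_le` for `b = k = 1`. -/
theorem iso_of_large_separator_of_one (hG : G.Connected)
    (hf : ∀ u v, u ∉ S → v ∉ S → G.Adj u v → f u = f v) (hsurj : ∀ i, ∃ v, v ∉ S ∧ f v = i)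
    (hd : 2 ≤ d) (hdS : d ≤ S.card) (hι : Fintype.card ι = S.card + 1)
    (hV : Fintype.card V = d + m + d) (hdm : 6 * d ^ 2 + 2 ≤ m)
    (h : IsPerronTriple d m d a r y) (hη : distSignlessRadius G ≤ y) :
    Nonempty (G ≃g joinCliqueIndep d m d) := by
  obtain ⟨t, ht⟩ := Nat.exists_eq_add_of_le hdS
  have hι' : Fintype.card ι = d + t + 1 := by omega
  have hVR : (Fintype.card V : ℝ) = d + m + d := by exact_mod_cast hV
  have hd2 : (2 : ℝ) ≤ d := by exact_mod_cast hd
  have hdmR : 6 * (d : ℝ) ^ 2 + 2 ≤ m := by exact_mod_cast hdm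
  have hm1R : (1 : ℝ) ≤ m := by nlinarith
  have hq := h.quadratic_le (by linarith) (by linarith) hm1R
  have hW := two_mul_mul_one_add_sq_le hd2 hq
  have hW2 : (d : ℝ) * (1 + r) ^ 2 ≤ 2 * m := by nlinarith
  have hcompl := card_le_card_compl_of_surjOn hsurj
  rw [hι', Finset.card_compl, hV, ht] at hcompl
  -- The transplanted Perron vector suffices while `t` is small against `m`; for larger `t` the
  -- vector with values `1` and `2` is used.
  rcases le_or_gt (8 * t) m with h8 | h8
  · obtain ⟨q, N, B, R, hR, hN, hB, h1, h2, h3⟩ := gain_le_loss_of_large_separator hG hf hsurj hdS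
      (by rw [hι']; omega) hVR (by positivity) h hη
    have hst : (S.card : ℝ) - d = t := by rw [ht]; push_cast; ring
    rw [hst] at hN h1 h2
    rw [hι'] at hB
    push_cast at hB
    obtain ⟨hB0, ht0⟩ := gain_le_loss_of_one (W := (1 + r) ^ 2) (by linarith) hd2 hW2
      (Nat.cast_nonneg t) hR hN (by exact_mod_cast h8) (by linarith) h1 h2
    have ht0' : t = 0 := by exact_mod_cast ht0
    subst ht0'
    have hcl := h3 hB0 (by omega) (by simpa using hι')
    exact nonempty_iso_joinCliqueIndep hf (by omega) (by simpa using hι') hV q hcl.1 hcl.2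
  · exfalso
    have hL : (Sᶜ.card : ℝ) = d + m - t := by
      have : Sᶜ.card + t = d + m := by rw [Finset.card_compl, hV, ht]; omega
      have : (Sᶜ.card : ℝ) + t = d + m := by exact_mod_cast this
      linarith
    have hray := rayleigh_separator_one_two hG hf hsurj (s := d + t) (n := d + m + d)
      (Q := d + t + 1) (by exact_mod_cast ht) hL hVR (by exact_mod_cast hι')
    have hy := h.y_le (by linarith) (by linarith) hm1R
    have h8R : (m : ℝ) ≤ 8 * t := by exact_mod_cast h8.le
    have htm : 2 * (t : ℝ) + 1 ≤ m := by
      have : 2 * t + 1 ≤ m := by omega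
      exact_mod_cast this
    have hex := excess_pos (n := d + m + d) (s := d + t) (g := 2 * (d * r)) hd2 (by linarith)
      (two_mul_mul_le hd2 (by linarith)) (by linarith) (by linarith)
    have hpos : (0 : ℝ) ≤ d + t + 4 * (d + m - t) := by linarith
    have h5 := mul_le_mul_of_nonneg_right (hη.trans hy) hpos
    nlinarith

/-- A separator smaller than that of the extremal graph is impossible; `b ≥ 3`. -/
theorem false_of_small_separator_of_three_le (hG : G.Connected)
    (hf : ∀ u v, u ∉ S → v ∉ S → G.Adj u v → f u = f v)
    (hcl : ∀ i, d < S.card + (sepClass S f i).card)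
    (hb : 3 ≤ b) (hkS : k < S.card) (hdS : S.card < d) (hι : Fintype.card ι = b * (S.card - k) + 2)
    (hp : p = b * (d - k) + 1) (hV : Fintype.card V = d + m + p) (hpm : 5 * p ≤ m)
    (h : IsPerronTriple d m p a r y) (hη : distSignlessRadius G ≤ y) : False := by
  obtain ⟨t, ht⟩ := Nat.exists_eq_add_of_lt hdS
  obtain ⟨e, he⟩ := Nat.exists_eq_add_of_lt hkS
  have e1 : S.card - k = e + 1 := by omega
  have e2 : d - k = e + 1 + (t + 1) := by omega
  rw [e1] at hι
  rw [e2] at hp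
  have hιne : Nonempty ι := Fintype.card_pos_iff.1 (by omega)
  have hVR : (Fintype.card V : ℝ) = d + m + p := by exact_mod_cast hV
  have hd0 : (0 : ℝ) < d := by
    have : 0 < d := by omega
    exact_mod_cast this
  have hbR : (3 : ℝ) ≤ b := by exact_mod_cast hb
  have hpR : (p : ℝ) = b * (e + 1 + (t + 1)) + 1 := by exact_mod_cast hp
  have he0 : (0 : ℝ) ≤ e := Nat.cast_nonneg e
  have ht0 : (0 : ℝ) ≤ t := Nat.cast_nonneg t
  have hbe : 0 ≤ (b : ℝ) * e := by positivity
  have hbt : 3 * ((t : ℝ) + 1) ≤ b * (t + 1) := mul_le_mul_of_nonneg_right hbR (by linarith)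
  have hp3 : 3 * ((t + 1 : ℝ) + 1) < p := by nlinarith
  have hpmR : 5 * (p : ℝ) ≤ m := by exact_mod_cast hpm
  have hm1R : (1 : ℝ) ≤ m := by linarith
  have hp0 : (0 : ℝ) < p := by linarith
  have hq := h.quadratic_le hd0 hp0 hm1R
  have ha := h.half_le_a hd0 hp0 hm1R (by linarith)
  -- The deficit `d - |S|` is `t + 1` here, and `κ` may be as large as the deficit.
  obtain ⟨R, hR, hle⟩ := gain_le_loss_of_small_separator hG hf (t := t + 1) (κ := t + 1)
    (by omega) (fun i => by have := hcl i; omega) le_rfl (by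
      rw [hι, hp]
      have : b * (e + 1) + 2 - 1 = b * (e + 1) + 1 := by omega
      rw [this]
      nlinarith [Nat.zero_le (b * e * (t + 1)), Nat.zero_le (b * (t + 1))]) hVR (by linarith) h hη ha
  have hR' : ((t + 1 : ℕ) : ℝ) ≤ R := by
    refine le_trans ?_ hR
    rw [hι, hpR]
    push_cast
    nlinarith [mul_nonneg hbe (by linarith : (0 : ℝ) ≤ t + 1)]
  have hgain := small_separator_gain_of_three_le (t := (t + 1 : ℕ)) (p := p) hm1R
    (h.one_le_r hd0 hp0 hm1R) ha (by exact_mod_cast hp3) (by push_cast; linarith) hR' hq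
    (mul_one_add_sq_le hp0 h.r_pos hq hpmR)
  linarith

/-- The analogue of `false_of_small_separator_of_three_le` for `b = k = 1`. -/
theorem false_of_small_separator_of_one (hG : G.Connected)
    (hf : ∀ u v, u ∉ S → v ∉ S → G.Adj u v → f u = f v)
    (hcl : ∀ i, d < S.card + (sepClass S f i).card)
    (hS2 : 2 ≤ S.card) (hdS : S.card < d) (hι : Fintype.card ι = S.card + 1)
    (hV : Fintype.card V = d + m + d) (hdm : 6 * d ^ 2 + 2 ≤ m)
    (h : IsPerronTriple d m d a r y) (hη : distSignlessRadius G ≤ y) : False := by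
  obtain ⟨t, ht1, ht⟩ : ∃ t, 1 ≤ t ∧ S.card + t = d := ⟨d - S.card, by omega, by omega⟩
  have hιne : Nonempty ι := Fintype.card_pos_iff.1 (by omega)
  have hVR : (Fintype.card V : ℝ) = d + m + d := by exact_mod_cast hV
  have hd3 : (3 : ℝ) ≤ d := by
    have : 3 ≤ d := by omega
    exact_mod_cast this
  have hd0 : (0 : ℝ) < d := by linarith
  have hdmR : 6 * (d : ℝ) ^ 2 + 2 ≤ m := by exact_mod_cast hdm
  have hm1R : (1 : ℝ) ≤ m := by nlinarith
  have hq := h.quadratic_le hd0 hd0 hm1R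
  have ha := h.half_le_a hd0 hd0 hm1R (by nlinarith)
  have hr := h.one_le_r hd0 hd0 hm1R
  have htR : (S.card : ℝ) + t = d := by exact_mod_cast ht
  have ht1R : (1 : ℝ) ≤ t := by exact_mod_cast ht1
  have hS2R : (2 : ℝ) ≤ S.card := by exact_mod_cast hS2
  have hcomp : ∀ κ : ℕ, κ ≤ t → d ≤ S.card * (κ + 1) → ∃ R : ℝ, (S.card - 1 : ℝ) * t ≤ R ∧
      d * t * (r + a) ^ 2 + 2 * m * R - 2 * r ^ 2 * κ * d - (1 + r) ^ 2 * (κ + 1) * R ≤ 0 := by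
    intro κ hκt hκd
    obtain ⟨R, hR, hle⟩ := gain_le_loss_of_small_separator hG hf ht
      (fun i => by have := hcl i; omega) hκt (by rw [hι, Nat.add_sub_cancel]; exact hκd) hVR
      (by linarith) h hη ha
    refine ⟨R, le_trans (le_of_eq ?_) hR, hle⟩
    rw [hι, ← htR]
    push_cast
    ring
  rcases Nat.lt_or_ge 2 S.card with hS3 | hS3
  · have hS3R : (3 : ℝ) ≤ S.card := by exact_mod_cast hS3
    obtain ⟨R, hR, hle⟩ := hcomp t le_rfl (by rw [← ht]; nlinarith)
    have := small_separator_gain_of_one (t := t) (R := R) hr ha (by linarith) ht1R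
      (by nlinarith) hq (by linarith)
    linarith
  · have hSe : S.card = 2 := le_antisymm hS3 hS2
    rw [hSe] at hcomp htR ht
    push_cast at htR
    rcases Nat.lt_or_ge 1 t with ht2 | ht2
    -- Only two classes besides the largest remain for the `d = t + 2` values `r`; this `κ` splits
    -- them as evenly as possible.
    · obtain ⟨R, hR, hle⟩ := hcomp ((t + 1) / 2) (by omega) (by omega)
      have hκ : 2 * (((t + 1) / 2 : ℕ) : ℝ) ≤ t + 1 := by
        have : 2 * ((t + 1) / 2) ≤ t + 1 := by omega
        exact_mod_cast this
      push_cast at hR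
      have := small_separator_gain_of_two_le (t := t) (R := R) hr ha (by linarith)
        (by exact_mod_cast ht2) hκ (by linarith) hq (by linarith)
      linarith
    · have hte : t = 1 := le_antisymm ht2 ht1
      subst hte
      have hd : d = 3 := by omega
      subst hd
      obtain ⟨R, hR, hle⟩ := hcomp 1 le_rfl (by norm_num)
      push_cast at hR hle hq hdmR
      have hm56 : (56 : ℝ) ≤ m := by linarith
      have ha' := h.three_quarters_le_a hd0 hd0 hm1R (by
        push_cast
        by_contra hlt
        push Not at hlt
        have : 6 ≤ r := by linarith
        nlinarith)
      have := small_separator_gain_of_eq_one hr ha' (by linarith : (1 : ℝ) ≤ R) hq hm56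
      linarith

end Main

theorem theorem1p6 (b k n δ : ℕ) (hb : 0 < b) (hk : 0 < k) (hn : 0 < n)
    (hnk : n ≡ k [MOD 2]) (hb_odd : b ≡ 1 [MOD 2]) (hkb : k ≤ b)
    {V : Type*} [Fintype V] [DecidableEq V] (G : SimpleGraph V) [DecidableRel G.Adj]
    (hcard : Fintype.card V = n) (hconn : IsKConnected G (k + 1)) (hδ : G.minDegree = δ)
    (hbound : max ((2 * (b : ℝ) ^ 2 + 4 * b) * (δ : ℝ) ^ 2 + 2 * δ + 2 * (b : ℝ) ^ 2 * (k : ℝ) ^ 2)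
      (6 / 5 * (b : ℝ) ^ 2 * (δ : ℝ) ^ 3 + 8 / 5 * (b : ℝ) ^ 2 * k * (δ : ℝ) ^ 2) ≤ (n : ℝ))
    (hη : distSignlessRadius G ≤ distSignlessRadius (extremalGraph n b k δ)) :
    IsKCriticalOddFactor G k b ∨ Nonempty (G ≃g extremalGraph n b k δ) := by
  have hodd : Odd b := Nat.odd_iff.2 hb_odd
  by_cases hcrit : IsKCriticalOddFactor G k b
  · exact Or.inl hcrit
  right
  obtain ⟨S, f, hkS, hf, hsurj⟩ :=
    exists_separator_of_not_critical hodd (hcard ▸ hnk) hconn hcrit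
  have hkδ : k < δ := hδ ▸ hconn.lt_minDegree
  have hG := hconn.connected
  have hbd : (2 * b ^ 2 + 4 * b) * δ ^ 2 + 2 * δ + 2 * b ^ 2 * k ^ 2 ≤ n := by
    exact_mod_cast (le_max_left _ _).trans hbound
  have hcl : ∀ i, δ < S.card + (sepClass S f i).card := fun i =>
    hδ ▸ minDegree_lt_card_add_card_sepClass hf (hsurj i)
  obtain ⟨p, hp⟩ : ∃ p, p = b * (δ - k) + 1 := ⟨_, rfl⟩
  have hp' : b * δ - b * k + 1 = p := by rw [hp, Nat.mul_sub]
  have hpδ : p ≤ b * δ := by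
    have : b * k ≤ b * δ := Nat.mul_le_mul_left b hkδ.le
    have : 1 ≤ b * k := Nat.mul_pos hb hk
    omega
  have hδ2 : 2 ≤ δ := by omega
  have hbδ : b * δ * 2 ≤ b * δ ^ 2 := by
    rw [pow_two, ← mul_assoc]
    exact Nat.mul_le_mul_left _ hδ2
  have hb1 : b * δ ^ 2 ≤ b ^ 2 * δ ^ 2 := Nat.mul_le_mul_right _ (by nlinarith)
  have hδb : δ ≤ b * δ := Nat.le_mul_of_pos_left δ hb
  have hbk : b * k ≤ b * δ := Nat.mul_le_mul_left b hkδ.le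
  have hmul : (b + 1) * δ = b * δ + δ := by ring
  have hmul2 : (2 * b ^ 2 + 4 * b) * δ ^ 2 = 2 * (b ^ 2 * δ ^ 2) + 4 * (b * δ ^ 2) := by ring
  obtain ⟨m, hm⟩ : ∃ m, m = n + b * k - (b + 1) * δ - 1 := ⟨_, rfl⟩
  have hV : Fintype.card V = δ + m + p := by
    rw [hcard, hm, ← hp', hmul]
    omega
  -- Apart from making the orders add up, the lower bound on `n` enters the comparison as this
  -- inequality, and as `hdm` when `b = 1`.
  have hpm : 5 * p ≤ m := by
    rw [hcard] at hV
    have := Nat.zero_le (2 * b ^ 2 * k ^ 2)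
    omega
  rw [show extremalGraph n b k δ = joinCliqueIndep δ (n + b * k - (b + 1) * δ - 1)
    (b * δ - b * k + 1) from rfl, hp', ← hm] at hη ⊢
  obtain ⟨a, r, ha, hr, h1, h2, h3⟩ := exists_perron_joinCliqueIndep (s := δ) (m := m) (t := p)
    (by omega) (by omega) (by omega)
  have hP : IsPerronTriple δ m p a r (distSignlessRadius (joinCliqueIndep δ m p)) :=
    ⟨ha, hr, h1, h2, h3⟩
  rcases Nat.lt_or_ge 2 b with hb3 | hb2
  · rcases le_or_gt δ S.card with hS | hS
    · exact iso_of_large_separator_of_three_le hG hf hsurj hb3 hkδ hS (Fintype.card_fin _) hp hV hpm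
        hP hη
    · exact (false_of_small_separator_of_three_le hG hf hcl hb3 hkS hS (Fintype.card_fin _) hp hV
        hpm hP hη).elim
  · have hbe : b = 1 := by
      obtain ⟨c, hc⟩ := hodd
      omega
    subst hbe
    have hke : k = 1 := by omega
    subst hke
    have hpe : p = δ := by omega
    subst hpe
    have hdm : 6 * p ^ 2 + 2 ≤ m := by omega
    rcases le_or_gt p S.card with hS | hS
    · exact iso_of_large_separator_of_one hG hf hsurj hδ2 hS (by rw [Fintype.card_fin]; omega) hV hdm
        hP hη
    · exact (false_of_small_separator_of_one hG hf hcl hkS hS (by rw [Fintype.card_fin]; omega) hV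
        hdm hP hη).elim
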